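/- Let $\mathbb Z_q=\{i\in\mathbb Z: -q/2\le i<q/2\}$ and let $a \bmod q$ denote the representative of $a$ in $\mathbb Z_q$. Write $\mathcal N_{\mathbb Z_q}(0,V)$ for the distribution on $\mathbb Z_q$ with probabilities proportional to $e^{-x^2/(2V)}$, and $\eta_\epsilon$ for the smoothing parameter of the lattice $\mathbb Z$ (the least $t>0$ with $\sum_{k\in\mathbb Z\setminus\{0\}}e^{-\pi t^2k^2}\le\epsilon$). A message vector $m$ is encrypted entrywise as $(P,\;Ps+rm+e \bmod q)$, with public matrix $P\in\mathbb Z^{n\times v}$, secret vector $s\in\mathbb Z^v$, integer scaling $r>0$, and independent errors $e_i\sim\mathcal N_{\mathbb Z_q}(0,\sigma^2)$. For an integer matrix $T_c\in\mathbb Z^{N\times n}$ the encrypted residual is $\rho^e=(T_cP \bmod q,\;T_c(Ps+rm+e \bmod q) \bmod q)$. The null hypothesis $\mathcal H_0$ is that the plaintext residual vanishes, $T_cm=0 \bmod q$. Let $\Sigma_p=\sigma^2T_cT_c^\top$. Let $d\in\mathbb Z_q^N$ lie in the $q$-ary kernel of the stacked public matrices of the residual, $d^\top T_cP=0 \bmod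 q$, and put $c=T_c^\top d$. Let $\sigma>0$ and $0<\epsilon<1$, and assume that 1. the entries of $c$ have greatest common divisor $1$; 2. $\|c\|_2^2\,\eta_\epsilon^2\le\sigma^2$; 3. $\sigma^2<\frac{q^2}{4}\frac{\Omega^2}{\|c\|_2^2}$ for some $0<\Omega<1$, and $\Pr(\|c\|_2|E|>q/2)\le\kappa\epsilon$ for $E\sim\mathcal N_{\mathbb Z_q}(0,\sigma^2)$. Then $d^\top\rho^e \bmod q=(0,X)$ for some $X$, and there is a constant $C$ depending only on $\kappa$ such that, under $\mathcal H_0$, for every realization of the public matrix and of the secret: * the statistical distance between the law of $X$ and $\mathcal N_{\mathbb Z_q}(0,d^\top\Sigma_pd)$ is at most $C\epsilon$; * if $\gamma$ is the two-sided $\alpha$-quantile, that is $\Pr(|Y|\ge\gamma)=\alpha$ for $Y\sim\mathcal N_{\mathbb Z_q}(0,d^\top\Sigma_pd)$, then the rule "reject $\mathcal H_0$ when $|X|\ge\gamma$" has Type I error probability within $C\epsilon$ of $\alpha$. The rule uses only the ciphertext, $d$ and $\gamma$, and $\gamma$ depends only on $q,\sigma,T_c,d,\alpha$; the secret vector $s$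 is never used. -/

import Mathlib

open MeasureTheory ProbabilityTheory

/-- `ℤ_q`: the integers `i` with `-q/2 ≤ i < q/2`.  The matching reduction `a mod q ∈ ℤ_q`
(the representative in `[-q/2, q/2)`) is `Int.bmod a q`. -/
noncomputable def Zq (q : ℕ) : Finset ℤ :=
  (Finset.Icc (-(q : ℤ)) q).filter (fun i => -(q : ℤ) ≤ 2 * i ∧ 2 * i < q)

/-- The probability mass function of the discrete normal distribution on the finite support `S`,
with parameters `m` (centre) and `V` (variance parameter); it vanishes off `S`. -/
noncomputable def discreteNormal (S : Finset ℤ) (m V : ℝ) (x : ℤ) : ℝ :=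
  if x ∈ S then
    Real.exp (-((x : ℝ) - m) ^ 2 / (2 * V)) / ∑ y ∈ S, Real.exp (-((y : ℝ) - m) ^ 2 / (2 * V))
  else 0

/-- `Pr(|Y| ≥ γ)` for `Y` discrete normal on `ℤ_q`, centred at `0`, with variance parameter `V`. -/
noncomputable def twoSidedTail (q : ℕ) (V γ : ℝ) : ℝ :=
  ∑ x ∈ (Zq q).filter (fun x : ℤ => γ ≤ |(x : ℝ)|), discreteNormal (Zq q) 0 V x

/-- `Pr(‖c‖₂ |E| > q/2)` for `E` discrete normal on `ℤ_q`, centred at `0`, with variance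
parameter `V`; `R` plays the role of `‖c‖₂`. -/
noncomputable def overflowProb (q : ℕ) (V R : ℝ) : ℝ :=
  ∑ x ∈ (Zq q).filter (fun x : ℤ => (q : ℝ) / 2 < R * |(x : ℝ)|), discreteNormal (Zq q) 0 V x

/-- Statistical (total variation) distance of two mass functions on `ℤ_q`. -/
noncomputable def statDist (q : ℕ) (f g : ℤ → ℝ) : ℝ :=
  (1 / 2) * ∑ x ∈ Zq q, |f x - g x|

/-- Euclidean norm of an integer vector. -/
noncomputable def l2norm {n : ℕ} (x : Fin n → ℤ) : ℝ :=
  Real.sqrt (∑ i, (x i : ℝ) ^ 2)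

/-- The dual of a lattice `L`: the vectors of its real span with integer inner products against
all of `L`. -/
def dualLattice {E : Type*} [NormedAddCommGroup E] [InnerProductSpace ℝ E]
    (L : Submodule ℤ E) : Set E :=
  {w | w ∈ Submodule.span ℝ (L : Set E) ∧ ∀ x ∈ L, ∃ k : ℤ, inner ℝ w x = (k : ℝ)}

/-- The smoothing parameter `η_ε(L)`: the smallest `t > 0` such that the nonzero dual vectors have
total Gaussian weight `∑ exp(-π t² ‖w‖²) ≤ ε`. -/
noncomputable def smoothingParameter {E : Type*} [NormedAddCommGroup E] [InnerProductSpace ℝ E]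
    (L : Submodule ℤ E) (ε : ℝ) : ℝ :=
  sInf {t : ℝ | 0 < t ∧
    ∑' w : {w : E // w ∈ dualLattice L ∧ w ≠ 0},
      ENNReal.ofReal (Real.exp (-Real.pi * t ^ 2 * ‖(w : E)‖ ^ 2)) ≤ ENNReal.ofReal ε}

/-- The lattice `ℤ ⊂ ℝ`. -/
noncomputable def intLattice : Submodule ℤ ℝ := Submodule.span ℤ {(1 : ℝ)}

/-- A ciphertext: public matrix and masked message.  A batch of messages encrypted under one secret
vector is the encryption of the stacked message, with the stacked public matrix. -/
abbrev Ciphertext (n v : ℕ) : Type := Matrix (Fin n) (Fin v) ℤ × (Fin n → ℤ)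

/-- Encryption `(P, P s + m r + e mod q)` of the message `m` with secret `s` and error `e`. -/
def lweEnc (q : ℕ) (r : ℤ) {n v : ℕ} (P : Matrix (Fin n) (Fin v) ℤ) (s : Fin v → ℤ)
    (m e : Fin n → ℤ) : Ciphertext n v :=
  (P, fun i => Int.bmod ((P.mulVec s) i + m i * r + e i) q)

/-- The integer-linear combinations of the rows of a ciphertext given by the rows of `T`,
modulo `q`. -/
def linComb (q : ℕ) {n N v : ℕ} (T : Matrix (Fin N) (Fin n) ℤ) (ct : Ciphertext n v) :
    Ciphertext N v :=
  (fun i j => Int.bmod ((T * ct.1) i j) q, fun i => Int.bmod ((T.mulVec ct.2) i) q)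

/-- The `q`-ary kernel `{x ∈ ℤ_q^N | V x = 0 mod q}`. -/
def qKer (q : ℕ) {l N : ℕ} (V : Matrix (Fin l) (Fin N) ℤ) : Set (Fin N → ℤ) :=
  {x | (∀ j, x j ∈ Zq q) ∧ ∀ i, Int.bmod ((V.mulVec x) i) q = 0}

/-- The matrix of public keys of a ciphertext: its `k`-th column is the (vectorized) public row
`P_k` of the `k`-th entry. -/
def publicColumns {N v : ℕ} (ct : Ciphertext N v) : Matrix (Fin v) (Fin N) ℤ :=
  ct.1.transpose

/-- `dᵀ ct mod q`, for both components of a ciphertext. -/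
def filtered (q : ℕ) {N v : ℕ} (d : Fin N → ℤ) (ct : Ciphertext N v) : (Fin v → ℤ) × ℤ :=
  (fun j => Int.bmod ((Matrix.vecMul d ct.1) j) q, Int.bmod (d ⬝ᵥ ct.2) q)

/-- The detector's decision to reject the null hypothesis: `|X| ≥ γ`, where `dᵀ ct mod q = (_, X)`.
It reads the ciphertext, the filtering vector and the threshold, and nothing else. -/
def Rejects (q : ℕ) {N v : ℕ} (d : Fin N → ℤ) (γ : ℝ) (ct : Ciphertext N v) : Prop :=
  γ ≤ |((filtered q d ct).2 : ℝ)|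

/-- The covariance matrix `σ² T Tᵀ` of the error `T e` of the residual. -/
noncomputable def residualCov (σ : ℝ) {n N : ℕ} (T : Matrix (Fin N) (Fin n) ℤ) :
    Matrix (Fin N) (Fin N) ℝ :=
  σ ^ 2 • (T.map (Int.cast : ℤ → ℝ) * (T.map (Int.cast : ℤ → ℝ)).transpose)

/-- The quadratic form `dᵀ S d`. -/
def quadForm {N : ℕ} (S : Matrix (Fin N) (Fin N) ℝ) (d : Fin N → ℤ) : ℝ :=
  (fun k => (d k : ℝ)) ⬝ᵥ S.mulVec (fun k => (d k : ℝ))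

/-! Filtering kills the public-key part (`d` is in the kernel) and, under the null hypothesis, the
message part, so `X` is `∑ i, c i * e i` reduced mod `q`. It remains to show that this combined
noise is almost the discrete normal with variance `R² σ²`, where `R = ‖c‖₂`.

Replace each error by the untruncated discrete Gaussian on `ℤ`; multiplied by `c i`, it becomes a
Gaussian on `c i ℤ`. Independent Gaussians on `gℤ` and `hℤ` add up to nearly a Gaussian on `gcd(g,
h)ℤ`: completing the square leaves a Gaussian sum over a shift of `lcm(g, h)ℤ`, and Poisson
summation makes that sum almost independent of the shift (`deficit_conv_latticeGaussian_le`). With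
the summands added one at a time, the error after `k` of them is of order `y ^ k` with `y = ε / 2`,
because `k` nonzero multiples of `g` have squares summing to at least `k g²`. The errors form a
geometric series, so the constant does not depend on the dimension, and coprimality makes the final
lattice `ℤ`.

Truncation costs at most `R²` tails of the individual errors (at most `R²` coefficients are nonzero)
and one tail of the sum. Both are compared with `Pr(R |E| > q/2) ≤ κ ε` through a lower bound on
that probability (`tailMass_bounds`).

Distances are measured one-sidedly, as the mass by which the target exceeds the actual law.
Reduction mod `q` only adds mass inside `Zq`, so wrap-around is free; equal total masses turn the
one-sided bound into a bound on statistical distance and on every event, including rejection. -/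

open scoped ENNReal Matrix

/-! ### One-sided distance and convolution -/

/-- The total amount by which `f` exceeds `g`.  For two probability mass functions this is their
total variation distance. -/
noncomputable def deficit (f g : ℤ → ℝ≥0∞) : ℝ≥0∞ := ∑' z, (f z - g z)

/-- Convolution of nonnegative functions on `ℤ`. -/
noncomputable def conv (f g : ℤ → ℝ≥0∞) (z : ℤ) : ℝ≥0∞ := ∑' x, f x * g (z - x)

theorem deficit_triangle (f g h : ℤ → ℝ≥0∞) : deficit f h ≤ deficit f g + deficit g h := by
  unfold deficit
  rw [← ENNReal.tsum_add]
  exact ENNReal.tsum_le_tsum fun z => tsub_le_tsub_add_tsub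

theorem tsum_tsub_le {α : Type*} (f g : α → ℝ≥0∞) :
    ∑' a, f a - ∑' a, g a ≤ ∑' a, (f a - g a) := by
  rw [tsub_le_iff_right, ← ENNReal.tsum_add]
  exact ENNReal.tsum_le_tsum fun z => le_tsub_add

theorem tsum_conv (f g : ℤ → ℝ≥0∞) : ∑' z, conv f g z = (∑' x, f x) * ∑' y, g y := by
  unfold conv
  rw [ENNReal.tsum_comm, ← ENNReal.tsum_mul_right]
  refine tsum_congr fun x => ?_
  rw [ENNReal.tsum_mul_left]
  congr 1
  exact (Equiv.subRight x).tsum_eq g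

theorem conv_comm (f g : ℤ → ℝ≥0∞) : conv f g = conv g f := by
  ext z
  unfold conv
  rw [← (Equiv.subLeft z).tsum_eq]
  refine tsum_congr fun x => ?_
  simp [mul_comm]

/-- Truncated subtraction passes inside the convolution sum, and total mass is multiplicative under
convolution. -/
theorem deficit_conv_right (f g h : ℤ → ℝ≥0∞) :
    deficit (conv f h) (conv g h) ≤ deficit f g * ∑' y, h y := by
  calc deficit (conv f h) (conv g h)
      ≤ ∑' z, conv (fun x => f x - g x) h z := by
        refine ENNReal.tsum_le_tsum fun z => (tsum_tsub_le _ _).trans ?_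
        refine ENNReal.tsum_le_tsum fun x => ?_
        rw [tsub_le_iff_right, ← add_mul]
        gcongr
        exact le_tsub_add
    _ = _ := tsum_conv _ _

theorem deficit_conv_left (f g h : ℤ → ℝ≥0∞) :
    deficit (conv h f) (conv h g) ≤ (∑' y, h y) * deficit f g := by
  rw [conv_comm h f, conv_comm h g, mul_comm]
  exact deficit_conv_right f g h

/-- Adding the subtracted mass back gives `∑ max (f z) (g z)` on both sides, which is symmetric. -/
theorem deficit_comm {f g : ℤ → ℝ≥0∞} (hf : ∑' z, f z = 1) (hg : ∑' z, g z = 1) :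
    deficit f g = deficit g f := by
  have h1 : deficit f g + 1 = deficit g f + 1 := by
    conv_lhs => rw [← hg]
    conv_rhs => rw [← hf]
    unfold deficit
    rw [← ENNReal.tsum_add, ← ENNReal.tsum_add]
    refine tsum_congr fun z => ?_
    rw [tsub_add_eq_max, tsub_add_eq_max, max_comm]
  exact (ENNReal.add_left_inj ENNReal.one_ne_top).1 h1

theorem deficit_le_of_mul_le {f g : ℤ → ℝ≥0∞} (hf : ∑' z, f z = 1) {δ : ℝ≥0∞}
    (h : ∀ z, f z ≤ g z + δ * f z) : deficit f g ≤ δ := by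
  calc deficit f g ≤ ∑' z, δ * f z :=
        ENNReal.tsum_le_tsum fun z => tsub_le_iff_left.2 (h z)
    _ = δ := by rw [ENNReal.tsum_mul_left, hf, mul_one]

/-! ### Gaussian sums over shifted integers and Poisson summation -/

theorem summable_exp_neg_mul_int_sq {r : ℝ} (hr : 0 < r) :
    Summable fun n : ℤ => Real.exp (-r * (n : ℝ) ^ 2) := by
  have h1 : Real.exp (-r) < 1 := by rw [Real.exp_lt_one_iff]; linarith
  have hs : Summable fun n : ℕ => Real.exp (-r * (n : ℝ) ^ 2) := by
    refine Summable.of_nonneg_of_le (fun _ => (Real.exp_pos _).le) (fun n => ?_)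
      (summable_geometric_of_lt_one (Real.exp_pos _).le h1)
    rw [← Real.exp_nat_mul]
    apply Real.exp_le_exp.2
    have : (n : ℝ) ≤ (n : ℝ) ^ 2 := by exact_mod_cast Nat.le_self_pow two_ne_zero n
    nlinarith
  refine Summable.of_nat_of_neg ?_ ?_
  · simpa only [Int.cast_natCast] using hs
  · simpa only [Int.cast_neg, neg_sq, Int.cast_natCast] using hs

theorem summable_exp_neg_mul_sq_add {b : ℝ} (hb : 0 < b) (a : ℝ) :
    Summable fun n : ℤ => Real.exp (-b * (n + a) ^ 2) := by
  refine Summable.of_nonneg_of_le (fun _ => (Real.exp_pos _).le) (fun n => ?_)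
    ((summable_exp_neg_mul_int_sq (half_pos hb)).mul_left (Real.exp (b * a ^ 2)))
  rw [← Real.exp_add]
  apply Real.exp_le_exp.2
  nlinarith [mul_nonneg hb.le (sq_nonneg ((n : ℝ) + 2 * a))]

theorem tsum_exp_neg_mul_int_sq_eq {r : ℝ} (hr : 0 < r) :
    ∑' n : ℤ, Real.exp (-r * (n : ℝ) ^ 2) =
      1 + 2 * ∑' n : ℕ, Real.exp (-r * ((n : ℝ) + 1) ^ 2) := by
  have hs := summable_exp_neg_mul_int_sq hr
  have hs0 : Summable fun n : ℕ => Real.exp (-r * (n : ℝ) ^ 2) := by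
    simpa only [Int.cast_natCast, Function.comp_def] using
      hs.comp_injective (Nat.cast_injective (R := ℤ))
  have hs1 : Summable fun n : ℕ => Real.exp (-r * ((n : ℝ) + 1) ^ 2) := by
    simpa only [Nat.cast_add, Nat.cast_one] using (summable_nat_add_iff 1).2 hs0
  have e2 : ∀ n : ℕ, Real.exp (-r * (((-((n : ℤ) + 1) : ℤ) : ℝ)) ^ 2)
      = Real.exp (-r * ((n : ℝ) + 1) ^ 2) := by
    intro n; push_cast; rw [neg_sq]
  rw [tsum_of_nat_of_neg_add_one (f := fun n : ℤ => Real.exp (-r * (n : ℝ) ^ 2))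
    (by simpa only [Int.cast_natCast] using hs0) (by simpa only [e2] using hs1)]
  simp only [e2, Int.cast_natCast]
  rw [hs0.tsum_eq_zero_add]
  simp only [Nat.cast_zero, Nat.cast_add, Nat.cast_one]
  rw [zero_pow two_ne_zero, mul_zero, Real.exp_zero]
  ring

/-- Since `(n + 1)² ≥ n + 1`, each half of the series is dominated by a geometric series of ratio at
most `1 / 2`. -/
theorem tsum_exp_neg_mul_int_sq_le {r t : ℝ} (hr : 0 < r) (ht : Real.exp (-r) ≤ t)
    (ht' : t ≤ 1 / 2) : ∑' n : ℤ, Real.exp (-r * (n : ℝ) ^ 2) ≤ 1 + 4 * t := by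
  have h0 : 0 < Real.exp (-r) := Real.exp_pos _
  have hx : Real.exp (-r) ≤ 1 / 2 := ht.trans ht'
  have hgeo : HasSum (fun n : ℕ => Real.exp (-r) * Real.exp (-r) ^ n)
      (Real.exp (-r) * (1 - Real.exp (-r))⁻¹) :=
    (hasSum_geometric_of_lt_one h0.le (by linarith)).mul_left _
  have hbd : ∀ n : ℕ, Real.exp (-r * ((n : ℝ) + 1) ^ 2) ≤ Real.exp (-r) * Real.exp (-r) ^ n := by
    intro n
    rw [← Real.exp_nat_mul, ← Real.exp_add]
    apply Real.exp_le_exp.2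
    nlinarith [mul_nonneg hr.le (Nat.cast_nonneg (α := ℝ) n),
      mul_nonneg hr.le (sq_nonneg (n : ℝ))]
  have hs : Summable fun n : ℕ => Real.exp (-r * ((n : ℝ) + 1) ^ 2) :=
    Summable.of_nonneg_of_le (fun _ => (Real.exp_pos _).le) hbd hgeo.summable
  have hle : ∑' n : ℕ, Real.exp (-r * ((n : ℝ) + 1) ^ 2) ≤ 2 * t := by
    refine (hs.tsum_le_tsum hbd hgeo.summable).trans ?_
    rw [hgeo.tsum_eq]
    have : (1 - Real.exp (-r))⁻¹ ≤ 2 := by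
      rw [inv_le_comm₀ (by linarith) (by norm_num)]; linarith
    nlinarith
  rw [tsum_exp_neg_mul_int_sq_eq hr]
  linarith

theorem tsum_exp_neg_mul_sq_add {b : ℝ} (hb : 0 < b) (a : ℝ) :
    (∑' n : ℤ, Real.exp (-b * (n + a) ^ 2) : ℝ) =
      Real.sqrt (Real.pi / b) *
        (∑' n : ℤ, Complex.exp (-(Real.pi ^ 2 / b : ℝ) * n ^ 2 - 2 * Real.pi * Complex.I * a * n)) := by
  have hpi := Real.pi_pos
  have hA : 0 < (((Real.pi / b : ℝ) : ℂ)).re := by rw [Complex.ofReal_re]; positivity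
  -- The coefficient `-I * a` makes the theta identity's shift `I * (-I * a)` the real number `a`.
  have key := Complex.tsum_exp_neg_quadratic hA (-Complex.I * a)
  have hne : ((Real.pi / b : ℝ) : ℂ) ^ (1 / 2 : ℂ) = (Real.sqrt (Real.pi / b) : ℂ) := by
    rw [Real.sqrt_eq_rpow, Complex.ofReal_cpow (by positivity)]; norm_num
  have hs : (Real.sqrt (Real.pi / b) : ℂ) ≠ 0 := by
    exact_mod_cast (Real.sqrt_pos.2 (by positivity)).ne'
  rw [hne] at key
  have hb' : (b : ℂ) ≠ 0 := by exact_mod_cast hb.ne'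
  have hp' : (Real.pi : ℂ) ≠ 0 := by exact_mod_cast hpi.ne'
  have e1 : ∀ n : ℤ, Complex.exp (-(Real.pi : ℂ) / ((Real.pi / b : ℝ) : ℂ) * (n + Complex.I * (-Complex.I * a)) ^ 2)
      = ((Real.exp (-b * (n + a) ^ 2) : ℝ) : ℂ) := by
    intro n
    push_cast
    congr 1
    have : Complex.I * (-Complex.I * a) = a := by
      rw [← mul_assoc, mul_neg, Complex.I_mul_I]; ring
    rw [this]; field_simp
  simp only [e1] at key
  rw [← Complex.ofReal_tsum] at key
  rw [eq_comm, one_div, inv_mul_eq_iff_eq_mul₀ hs] at key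
  rw [key]
  congr 1
  refine tsum_congr fun n => ?_
  congr 1
  push_cast
  field_simp
  ring

/-- The Gaussian mass `∑ exp(-b (j + a)²)` of the shifted integers. -/
noncomputable def gaussianSum (b a : ℝ) : ℝ := ∑' j : ℤ, Real.exp (-b * (j + a) ^ 2)

theorem norm_poisson_term (r a : ℝ) (n : ℤ) :
    ‖Complex.exp (-(r : ℝ) * n ^ 2 - 2 * Real.pi * Complex.I * a * n)‖ =
      Real.exp (-r * (n : ℝ) ^ 2) := by
  rw [Complex.norm_exp]
  congr 1
  have : (-(r : ℂ) * n ^ 2 - 2 * Real.pi * Complex.I * a * n)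
      = ((-r * (n : ℝ) ^ 2 : ℝ) : ℂ) + ((-2 * Real.pi * a * n : ℝ) : ℂ) * Complex.I := by
    push_cast; ring
  rw [this]
  simp only [Complex.add_re, Complex.ofReal_re, Complex.re_ofReal_mul, Complex.I_re, mul_zero, add_zero]

theorem gaussianSum_zero {b : ℝ} (hb : 0 < b) :
    gaussianSum b 0 = Real.sqrt (Real.pi / b) * ∑' n : ℤ, Real.exp (-(Real.pi ^ 2 / b) * (n : ℝ) ^ 2) := by
  have key := tsum_exp_neg_mul_sq_add hb 0
  have : ∀ n : ℤ, Complex.exp (-(Real.pi ^ 2 / b : ℝ) * n ^ 2 - 2 * Real.pi * Complex.I * (0 : ℝ) * n)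
      = ((Real.exp (-(Real.pi ^ 2 / b) * (n : ℝ) ^ 2) : ℝ) : ℂ) := by
    intro n; push_cast; simp
  simp only [this, ← Complex.ofReal_tsum] at key
  apply Complex.ofReal_injective
  rw [Complex.ofReal_mul]
  exact key

/-- On the Fourier side a shift only multiplies the positive coefficients by phases, so no shift
beats zero. -/
theorem gaussianSum_le_zero {b : ℝ} (hb : 0 < b) (a : ℝ) : gaussianSum b a ≤ gaussianSum b 0 := by
  have hr : 0 < Real.pi ^ 2 / b := by have := Real.pi_pos; positivity
  have hn : 0 ≤ gaussianSum b a := tsum_nonneg fun _ => (Real.exp_pos _).le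
  have key := congrArg norm (tsum_exp_neg_mul_sq_add hb a)
  rw [norm_mul, Complex.norm_real, Complex.norm_real,
    Real.norm_of_nonneg (Real.sqrt_nonneg _)] at key
  change ‖gaussianSum b a‖ = _ at key
  rw [Real.norm_of_nonneg hn] at key
  rw [key, gaussianSum_zero hb]
  refine mul_le_mul_of_nonneg_left ?_ (Real.sqrt_nonneg _)
  refine (norm_tsum_le_tsum_norm ?_).trans_eq (tsum_congr fun n => norm_poisson_term _ _ _)
  simp only [norm_poisson_term]
  exact summable_exp_neg_mul_int_sq hr

theorem sqrt_le_gaussianSum_zero {b : ℝ} (hb : 0 < b) : Real.sqrt (Real.pi / b) ≤ gaussianSum b 0 := by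
  have hr : 0 < Real.pi ^ 2 / b := by have := Real.pi_pos; positivity
  rw [gaussianSum_zero hb, tsum_exp_neg_mul_int_sq_eq hr]
  have : 0 ≤ ∑' n : ℕ, Real.exp (-(Real.pi ^ 2 / b) * ((n : ℝ) + 1) ^ 2) :=
    tsum_nonneg fun _ => (Real.exp_pos _).le
  nlinarith [Real.sqrt_nonneg (Real.pi / b)]

theorem gaussianSum_zero_le {b t : ℝ} (hb : 0 < b) (ht : Real.exp (-(Real.pi ^ 2 / b)) ≤ t)
    (ht' : t ≤ 1 / 2) : gaussianSum b 0 ≤ Real.sqrt (Real.pi / b) * (1 + 4 * t) := by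
  have hr : 0 < Real.pi ^ 2 / b := by have := Real.pi_pos; positivity
  rw [gaussianSum_zero hb]
  exact mul_le_mul_of_nonneg_left (tsum_exp_neg_mul_int_sq_le hr ht ht') (Real.sqrt_nonneg _)

theorem le_gaussianSum {b t : ℝ} (hb : 0 < b) (ht : Real.exp (-(Real.pi ^ 2 / b)) ≤ t)
    (ht' : t ≤ 1 / 2) (a : ℝ) : Real.sqrt (Real.pi / b) * (1 - 4 * t) ≤ gaussianSum b a := by
  have hr : 0 < Real.pi ^ 2 / b := by have := Real.pi_pos; positivity
  have key := congrArg Complex.re (tsum_exp_neg_mul_sq_add hb a)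
  rw [Complex.re_ofReal_mul, Complex.ofReal_re] at key
  change gaussianSum b a = _ at key
  rw [key]
  refine mul_le_mul_of_nonneg_left ?_ (Real.sqrt_nonneg _)
  set F : ℤ → ℂ := fun n => Complex.exp (-(Real.pi ^ 2 / b : ℝ) * n ^ 2 - 2 * Real.pi * Complex.I * a * n) with hF
  have hFn : ∀ n, ‖F n‖ = Real.exp (-(Real.pi ^ 2 / b) * (n : ℝ) ^ 2) := fun n =>
    norm_poisson_term _ _ _
  have hFs : Summable fun n => ‖F n‖ := by
    simp only [hFn]; exact summable_exp_neg_mul_int_sq hr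
  have hF0 : F 0 = 1 := by simp [hF]
  have h1 := hFs.of_norm.tsum_eq_add_tsum_ite 0
  have h2 := hFs.tsum_eq_add_tsum_ite 0
  have h3 : ‖∑' n, (if n = 0 then 0 else F n)‖ ≤ ∑' n, (if n = 0 then 0 else ‖F n‖) := by
    have : ∀ n, ‖(if n = 0 then 0 else F n)‖ = if n = 0 then 0 else ‖F n‖ := by
      intro n; split_ifs <;> simp
    refine (norm_tsum_le_tsum_norm ?_).trans_eq (tsum_congr this)
    simp only [this]
    refine Summable.of_nonneg_of_le (fun n => ?_) (fun n => ?_) hFs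
    · split_ifs <;> simp
    · split_ifs <;> simp
  have h4 := tsum_exp_neg_mul_int_sq_le hr ht ht'
  simp only [← hFn] at h4
  rw [h2, hF0, norm_one] at h4
  rw [h1, hF0, Complex.add_re, Complex.one_re]
  have h5 := (Complex.abs_re_le_norm (∑' n, (if n = 0 then 0 else F n))).trans h3
  linarith [neg_abs_le (∑' n, (if n = 0 then 0 else F n)).re]

/-- Both sums lie within a factor `1 ± 4 t` of `√(π / b)`, which is itself at most the unshifted
sum. -/
theorem gaussianSum_zero_le_add {b t : ℝ} (hb : 0 < b) (ht : Real.exp (-(Real.pi ^ 2 / b)) ≤ t)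
    (ht' : t ≤ 1 / 2) (a : ℝ) : gaussianSum b 0 ≤ gaussianSum b a + 8 * t * gaussianSum b 0 := by
  have h1 := le_gaussianSum hb ht ht' a
  have h2 := sqrt_le_gaussianSum_zero hb
  have h3 := gaussianSum_zero_le hb ht ht'
  have h0 : 0 ≤ t := (Real.exp_pos _).le.trans ht
  nlinarith

/-! ### Discrete Gaussians on sublattices of `ℤ` -/

/-- The unnormalised Gaussian weight with variance parameter `V` on the lattice `gℤ`. -/
noncomputable def latticeWeight (g : ℤ) (V : ℝ) (z : ℤ) : ℝ≥0∞ :=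
  if g ∣ z then ENNReal.ofReal (Real.exp (-(z : ℝ) ^ 2 / (2 * V))) else 0

/-- The discrete Gaussian distribution with variance parameter `V` on the lattice `gℤ`. -/
noncomputable def latticeGaussian (g : ℤ) (V : ℝ) (z : ℤ) : ℝ≥0∞ :=
  latticeWeight g V z / ∑' x, latticeWeight g V x

theorem tsum_eq_tsum_coset {L : ℤ} (hL : L ≠ 0) (x₀ : ℤ) (f : ℤ → ℝ≥0∞)
    (hf : ∀ x, f x ≠ 0 → L ∣ x - x₀) : ∑' x, f x = ∑' j, f (x₀ + L * j) := by
  have hinj : Function.Injective fun j : ℤ => x₀ + L * j := fun i j h => by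
    simpa [hL] using h
  rw [← hinj.tsum_eq]
  intro x hx
  obtain ⟨j, hj⟩ := hf x hx
  exact ⟨j, by simp only [← hj]; ring⟩

theorem ofReal_gaussianSum {b : ℝ} (hb : 0 < b) (a : ℝ) :
    ∑' j : ℤ, ENNReal.ofReal (Real.exp (-b * (j + a) ^ 2)) = ENNReal.ofReal (gaussianSum b a) :=
  (ENNReal.ofReal_tsum_of_nonneg (fun _ => (Real.exp_pos _).le)
    (summable_exp_neg_mul_sq_add hb a)).symm

theorem tsum_latticeWeight {g : ℤ} (hg : g ≠ 0) {V : ℝ} (hV : 0 < V) :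
    ∑' z, latticeWeight g V z = ENNReal.ofReal (gaussianSum ((g : ℝ) ^ 2 / (2 * V)) 0) := by
  have hg' : (g : ℝ) ≠ 0 := by exact_mod_cast hg
  rw [tsum_eq_tsum_coset hg 0, ← ofReal_gaussianSum (by positivity)]
  · refine tsum_congr fun j => ?_
    simp only [latticeWeight, zero_add, dvd_mul_right, if_true]
    congr 2
    push_cast
    ring
  · intro x hx
    simp only [latticeWeight] at hx
    simpa using (ite_ne_right_iff.1 hx).1

theorem gaussianSum_nonneg (b a : ℝ) : 0 ≤ gaussianSum b a :=
  tsum_nonneg fun _ => (Real.exp_pos _).le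

theorem gaussianSum_zero_pos {b : ℝ} (hb : 0 < b) : 0 < gaussianSum b 0 :=
  (Real.sqrt_pos.2 (div_pos Real.pi_pos hb)).trans_le (sqrt_le_gaussianSum_zero hb)

theorem tsum_latticeWeight_ne_zero {g : ℤ} (hg : g ≠ 0) {V : ℝ} (hV : 0 < V) :
    ∑' z, latticeWeight g V z ≠ 0 := by
  have hg' : (g : ℝ) ≠ 0 := by exact_mod_cast hg
  rw [tsum_latticeWeight hg hV, ENNReal.ofReal_ne_zero_iff]
  exact gaussianSum_zero_pos (by positivity)

theorem tsum_latticeWeight_ne_top {g : ℤ} (hg : g ≠ 0) {V : ℝ} (hV : 0 < V) :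
    ∑' z, latticeWeight g V z ≠ ⊤ := by
  rw [tsum_latticeWeight hg hV]; exact ENNReal.ofReal_ne_top

theorem tsum_latticeGaussian {g : ℤ} (hg : g ≠ 0) {V : ℝ} (hV : 0 < V) :
    ∑' z, latticeGaussian g V z = 1 := by
  simp only [latticeGaussian, div_eq_mul_inv]
  rw [ENNReal.tsum_mul_right, ENNReal.mul_inv_cancel (tsum_latticeWeight_ne_zero hg hV)
    (tsum_latticeWeight_ne_top hg hV)]

/-- Completing the square splits off the weight of `z` with variance `V + W`; the remaining `x` with
`g ∣ x` and `h ∣ z - x` form a coset of `lcm(g, h)ℤ`, empty unless the gcd divides `z`. -/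
theorem exists_conv_latticeWeight {g h : ℤ} (hg : g ≠ 0) (hh : h ≠ 0) {V W : ℝ}
    (hV : 0 < V) (hW : 0 < W) (z : ℤ) : ∃ a : ℝ,
      conv (latticeWeight g V) (latticeWeight h W) z =
        latticeWeight (Int.gcd g h) (V + W) z *
          ENNReal.ofReal (gaussianSum ((Int.lcm g h : ℝ) ^ 2 * (V + W) / (2 * (V * W))) a) := by
  have hL : (Int.lcm g h : ℤ) ≠ 0 := by exact_mod_cast Int.lcm_ne_zero hg hh
  have hL' : (Int.lcm g h : ℝ) ≠ 0 := by exact_mod_cast hL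
  unfold conv
  by_cases hz : (Int.gcd g h : ℤ) ∣ z
  · obtain ⟨k, hk⟩ := hz
    -- Bézout supplies a base point of the coset.
    set x₀ : ℤ := g * (Int.gcdA g h * k) with hx₀
    have h1 : g ∣ x₀ := dvd_mul_right _ _
    have h2 : h ∣ z - x₀ := by
      rw [hk, Int.gcd_eq_gcd_ab]
      exact ⟨Int.gcdB g h * k, by rw [hx₀]; ring⟩
    -- The offset of the base point from the conditional mean `z V / (V + W)`, in units of the lcm.
    refine ⟨(x₀ - z * V / (V + W)) / Int.lcm g h, ?_⟩
    rw [tsum_eq_tsum_coset hL x₀, ← ofReal_gaussianSum (by positivity), ← ENNReal.tsum_mul_left]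
    · refine tsum_congr fun j => ?_
      have h3 : g ∣ x₀ + Int.lcm g h * j :=
        dvd_add h1 ((Int.dvd_lcm_left g h).mul_right _)
      have h4 : h ∣ z - (x₀ + Int.lcm g h * j) := by
        rw [← sub_sub]; exact dvd_sub h2 ((Int.dvd_lcm_right g h).mul_right _)
      have h5 : (Int.gcd g h : ℤ) ∣ z := ⟨k, hk⟩
      simp only [latticeWeight, h3, h4, h5, if_true]
      rw [← ENNReal.ofReal_mul (Real.exp_pos _).le, ← ENNReal.ofReal_mul (Real.exp_pos _).le,
        ← Real.exp_add, ← Real.exp_add]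
      congr 2
      push_cast
      field_simp
      ring
    · intro x hx
      have h3 := left_ne_zero_of_mul hx
      have h4 := right_ne_zero_of_mul hx
      simp only [latticeWeight] at h3 h4
      refine Int.coe_lcm_dvd (dvd_sub (ite_ne_right_iff.1 h3).1 h1) ?_
      have := dvd_sub h2 (ite_ne_right_iff.1 h4).1
      simpa using this
  · refine ⟨0, ?_⟩
    rw [latticeWeight, if_neg hz, zero_mul, ENNReal.tsum_eq_zero]
    intro x
    by_contra hx
    have h3 := left_ne_zero_of_mul hx
    have h4 := right_ne_zero_of_mul hx
    simp only [latticeWeight] at h3 h4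
    apply hz
    have := dvd_add ((Int.gcd_dvd_left g h).trans (ite_ne_right_iff.1 h3).1)
      ((Int.gcd_dvd_right g h).trans (ite_ne_right_iff.1 h4).1)
    simpa using this

/-- The sum of independent discrete Gaussians on `gℤ` and `hℤ` is close to the discrete Gaussian
on `gcd(g, h)ℤ`, with the variance parameters added. -/
theorem deficit_conv_latticeGaussian_le {g h : ℤ} (hg : g ≠ 0) (hh : h ≠ 0) {V W t : ℝ}
    (hV : 0 < V) (hW : 0 < W)
    (ht : Real.exp (-(2 * Real.pi ^ 2 * (V * W) / ((V + W) * (Int.lcm g h : ℝ) ^ 2))) ≤ t)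
    (ht' : t ≤ 1 / 2) :
    deficit (latticeGaussian (Int.gcd g h) (V + W))
      (conv (latticeGaussian g V) (latticeGaussian h W)) ≤ ENNReal.ofReal (8 * t) := by
  have hG : (Int.gcd g h : ℤ) ≠ 0 := by
    simp [hg]
  have hL' : (Int.lcm g h : ℝ) ≠ 0 := by exact_mod_cast Int.lcm_ne_zero hg hh
  have ht0 : 0 ≤ t := (Real.exp_pos _).le.trans ht
  choose a ha using exists_conv_latticeWeight hg hh hV hW
  set b : ℝ := (Int.lcm g h : ℝ) ^ 2 * (V + W) / (2 * (V * W)) with hb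
  have hb0 : 0 < b := by positivity
  have hbt : Real.exp (-(Real.pi ^ 2 / b)) ≤ t := by
    convert ht using 3
    rw [hb]; field_simp
  set M := ∑' z, latticeWeight g V z
  set N := ∑' z, latticeWeight h W z
  set K := ∑' z, latticeWeight (Int.gcd g h) (V + W) z with hK
  have hK0 : K ≠ 0 := tsum_latticeWeight_ne_zero hG (by positivity)
  have hKt : K ≠ ⊤ := tsum_latticeWeight_ne_top hG (by positivity)
  have hM0 : M ≠ 0 := tsum_latticeWeight_ne_zero hg hV
  have hMt : M ≠ ⊤ := tsum_latticeWeight_ne_top hg hV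
  set θ := ENNReal.ofReal (gaussianSum b 0) with hθ
  have hθ0 : θ ≠ 0 := (ENNReal.ofReal_pos.2 (gaussianSum_zero_pos hb0)).ne'
  have hθt : θ ≠ ⊤ := ENNReal.ofReal_ne_top
  -- As the deficit is one-sided, an upper bound on the normaliser suffices, and the zero shift
  -- gives it.
  have hMN : M * N ≤ K * θ := by
    rw [← tsum_conv, hK, ← ENNReal.tsum_mul_right]
    refine ENNReal.tsum_le_tsum fun z => ?_
    rw [ha]
    gcongr
    exact ENNReal.ofReal_le_ofReal (gaussianSum_le_zero hb0 _)
  refine deficit_le_of_mul_le (tsum_latticeGaussian hG (by positivity)) fun z => ?_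
  have hc : conv (latticeGaussian g V) (latticeGaussian h W) z =
      latticeWeight (Int.gcd g h) (V + W) z * ENNReal.ofReal (gaussianSum b (a z)) * (M * N)⁻¹ := by
    rw [← ha]
    unfold conv
    rw [← ENNReal.tsum_mul_right]
    refine tsum_congr fun x => ?_
    rw [ENNReal.mul_inv (Or.inl hM0) (Or.inl hMt)]
    simp only [latticeGaussian, div_eq_mul_inv]
    ring
  have hθa : θ ≤ ENNReal.ofReal (gaussianSum b (a z)) + ENNReal.ofReal (8 * t) * θ := by
    rw [hθ, ← ENNReal.ofReal_mul (by positivity), ← ENNReal.ofReal_add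
      (gaussianSum_nonneg b _)
      (mul_nonneg (by positivity) (gaussianSum_zero_pos hb0).le)]
    exact ENNReal.ofReal_le_ofReal (gaussianSum_zero_le_add hb0 hbt ht' _)
  rw [hc]
  simp only [latticeGaussian, div_eq_mul_inv]
  rw [← hK]
  set w := latticeWeight (Int.gcd g h) (V + W) z
  calc w * K⁻¹ = w * K⁻¹ * (θ⁻¹ * θ) := by rw [ENNReal.inv_mul_cancel hθ0 hθt, mul_one]
    _ ≤ w * K⁻¹ * (θ⁻¹ * (ENNReal.ofReal (gaussianSum b (a z)) + ENNReal.ofReal (8 * t) * θ)) := by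
        gcongr
    _ = w * ENNReal.ofReal (gaussianSum b (a z)) * (K * θ)⁻¹
        + ENNReal.ofReal (8 * t) * (w * K⁻¹) * (θ⁻¹ * θ) := by
        rw [ENNReal.mul_inv (Or.inl hK0) (Or.inl hKt)]; ring
    _ ≤ _ := by
        rw [ENNReal.inv_mul_cancel hθ0 hθt, mul_one]
        gcongr

/-! ### Laws of integer combinations of independent errors -/

/-- The mass function of an integer-valued random variable. -/
noncomputable def law {Ω : Type*} [MeasurableSpace Ω] (μ : Measure Ω) (X : Ω → ℤ) (z : ℤ) : ℝ≥0∞ :=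
  μ {ω | X ω = z}

theorem tsum_law {Ω : Type*} [MeasurableSpace Ω] (μ : Measure Ω) [IsProbabilityMeasure μ]
    {X : Ω → ℤ} (hX : Measurable X) : ∑' z, law μ X z = 1 := by
  have h : ∑' z, μ (X ⁻¹' {z}) = 1 := by
    rw [← measure_iUnion _ (fun i => hX (measurableSet_singleton i)), ← measure_univ (μ := μ)]
    · congr 1; ext ω; simp
    · refine fun i j hij => Set.disjoint_left.2 fun ω h1 h2 => hij ?_
      exact (show X ω = i from h1).symm.trans h2
  exact h

theorem law_add {Ω : Type*} [MeasurableSpace Ω] (μ : Measure Ω) {X Y : Ω → ℤ}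
    (hX : Measurable X) (hY : Measurable Y) (h : IndepFun X Y μ) :
    law μ (X + Y) = conv (law μ X) (law μ Y) := by
  ext z
  unfold law conv
  have hm : ∀ x, μ {ω | X ω = x} * μ {ω | Y ω = z - x} = μ ({ω | X ω = x} ∩ {ω | Y ω = z - x}) :=
    fun x => (h.measure_inter_preimage_eq_mul {x} {z - x} (measurableSet_singleton _)
      (measurableSet_singleton _)).symm
  simp only [hm]
  rw [← measure_iUnion]
  · congr 1
    ext ω
    simp only [Pi.add_apply, Set.mem_ofPred_eq, Set.mem_iUnion, Set.mem_inter_iff,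
      exists_eq_left']
    omega
  · intro i j hij
    refine Set.disjoint_left.2 fun ω h1 h2 => hij ?_
    exact (show X ω = i from h1.1).symm.trans h2.1
  · exact fun i => (hX (measurableSet_singleton i)).inter (hY (measurableSet_singleton _))

theorem latticeGaussian_mul {c : ℤ} (hc : c ≠ 0) {V : ℝ} (hV : 0 < V) (x : ℤ) :
    latticeGaussian c ((c : ℝ) ^ 2 * V) (c * x) = latticeGaussian 1 V x := by
  have hc' : (c : ℝ) ≠ 0 := by exact_mod_cast hc
  unfold latticeGaussian
  rw [tsum_latticeWeight hc (by positivity), tsum_latticeWeight one_ne_zero hV]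
  simp only [latticeWeight, dvd_mul_right, one_dvd, if_true]
  congr 3
  · push_cast; field_simp
  · push_cast; field_simp

theorem latticeGaussian_eq_zero {c z : ℤ} (V : ℝ) (h : ¬ c ∣ z) : latticeGaussian c V z = 0 := by
  simp [latticeGaussian, latticeWeight, h]

theorem deficit_latticeGaussian_law_mul {Ω : Type*} [MeasurableSpace Ω] (μ : Measure Ω)
    {c : ℤ} (hc : c ≠ 0) {V : ℝ} (hV : 0 < V) (X : Ω → ℤ) :
    deficit (latticeGaussian c ((c : ℝ) ^ 2 * V)) (law μ fun ω => c * X ω) =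
      deficit (latticeGaussian 1 V) (law μ X) := by
  unfold deficit
  rw [tsum_eq_tsum_coset hc 0]
  · refine tsum_congr fun x => ?_
    rw [zero_add, latticeGaussian_mul hc hV]
    simp [law, hc]
  · intro z hz
    rw [sub_zero]
    by_contra h
    simp [latticeGaussian_eq_zero _ h] at hz

theorem latticeGaussian_normalize (c : ℤ) (V : ℝ) :
    latticeGaussian (normalize c) V = latticeGaussian c V := by
  ext z
  simp only [latticeGaussian, latticeWeight, normalize_dvd_iff]

/-- Every nonzero multiple of the gcd is at least as large as it in absolute value. -/
theorem mul_gcd_sq_le_sum_sq {ι : Type*} (s : Finset ι) (c : ι → ℤ) (hc : ∀ i ∈ s, c i ≠ 0) :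
    (s.card : ℝ) * ((s.gcd c : ℤ) : ℝ) ^ 2 ≤ ∑ i ∈ s, (c i : ℝ) ^ 2 := by
  rw [← nsmul_eq_mul]
  refine Finset.card_nsmul_le_sum _ _ _ fun i hi => ?_
  have := Int.natAbs_le_of_dvd_ne_zero (Finset.gcd_dvd hi) (hc i hi)
  have h2 : (s.gcd c) ^ 2 ≤ (c i) ^ 2 := Int.natAbs_le_iff_sq_le.1 this
  exact_mod_cast h2

/-- The Poisson exponent gains a factor `k`: `lcm(g, h)² ≤ g² h²`, while `A` is at least `k g²`.
This makes the successive merging errors geometric. -/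
theorem smoothing_ratio_le {g h : ℤ} (hg : g ≠ 0) (hh : h ≠ 0) {A S V : ℝ} {k : ℕ}
    (hV : 0 < V) (hA : 0 < A) (hk : (k : ℝ) * (g : ℝ) ^ 2 ≤ A) (hS : A + (h : ℝ) ^ 2 ≤ S) :
    k * (2 * Real.pi ^ 2 * V / S) ≤
      2 * Real.pi ^ 2 * (A * V * ((h : ℝ) ^ 2 * V)) /
        ((A * V + (h : ℝ) ^ 2 * V) * (Int.lcm g h : ℝ) ^ 2) := by
  have hg' : (g : ℝ) ≠ 0 := by exact_mod_cast hg
  have hh' : (h : ℝ) ≠ 0 := by exact_mod_cast hh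
  have hL' : (Int.lcm g h : ℝ) ≠ 0 := by exact_mod_cast Int.lcm_ne_zero hg hh
  have hpi := Real.pi_pos
  have hL : (Int.lcm g h : ℝ) ^ 2 ≤ (g : ℝ) ^ 2 * (h : ℝ) ^ 2 := by
    have h1 : Int.lcm g h ≤ (g * h).natAbs :=
      Int.natAbs_le_of_dvd_ne_zero (Int.lcm_dvd_mul g h) (mul_ne_zero hg hh)
    have h2 : ((Int.lcm g h : ℤ)) ^ 2 ≤ (g * h) ^ 2 := Int.natAbs_le_iff_sq_le.1 (by simpa using h1)
    rw [← mul_pow]; exact_mod_cast h2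
  have hh2 : 0 < (h : ℝ) ^ 2 := by positivity
  have hS0 : 0 < S := by linarith
  calc k * (2 * Real.pi ^ 2 * V / S) = 2 * Real.pi ^ 2 * V * h ^ 2 * (k * g ^ 2) / (S * (g ^ 2 * h ^ 2)) := by
        field_simp
    _ ≤ 2 * Real.pi ^ 2 * V * h ^ 2 * A / ((A + h ^ 2) * (Int.lcm g h : ℝ) ^ 2) := by
        gcongr
    _ = _ := by field_simp

/-- Induction on the support: each new summand costs one `τ` for its own law and one merging error
`8 y ^ k`. The fixed bound `S` on the full sum of squares keeps `y` the same at every stage. -/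
theorem deficit_latticeGaussian_law_sum_le {Ω ι : Type*} [MeasurableSpace Ω] {μ : Measure Ω}
    [IsProbabilityMeasure μ] {e : ι → Ω → ℤ} (he : ∀ i, Measurable (e i)) (hi : iIndepFun e μ)
    {V : ℝ} (hV : 0 < V) {τ : ℝ≥0∞} (hτ : ∀ i, deficit (latticeGaussian 1 V) (law μ (e i)) ≤ τ)
    (c : ι → ℤ) {S y : ℝ} (hy : Real.exp (-(2 * Real.pi ^ 2 * V / S)) ≤ y) (hy' : y ≤ 1 / 2)
    {s : Finset ι} (hs : s.Nonempty) (hc : ∀ i ∈ s, c i ≠ 0) (hS : ∑ i ∈ s, (c i : ℝ) ^ 2 ≤ S) :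
    deficit (latticeGaussian (s.gcd c) ((∑ i ∈ s, (c i : ℝ) ^ 2) * V))
      (law μ (∑ i ∈ s, fun ω => c i * e i ω)) ≤
      s.card * τ + ENNReal.ofReal (∑ j ∈ Finset.range (s.card - 1), 8 * y ^ (j + 1)) := by
  have hy0 : 0 ≤ y := (Real.exp_pos _).le.trans hy
  have hm : ∀ i, Measurable fun ω => c i * e i ω := fun i => (he i).const_mul _
  have hi' : iIndepFun (fun i ω => c i * e i ω) μ :=
    hi.comp (fun i x => c i * x) fun i => measurable_const_mul _
  induction hs using Finset.Nonempty.cons_induction with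
  | singleton a =>
    have ha : c a ≠ 0 := hc a (by simp)
    simp only [Finset.gcd_singleton, Finset.sum_singleton, latticeGaussian_normalize,
      Finset.card_singleton]
    rw [deficit_latticeGaussian_law_mul μ ha hV]
    simpa using hτ a
  | cons a s has hs ih =>
    have ha : c a ≠ 0 := hc a (by simp)
    have hcs : ∀ i ∈ s, c i ≠ 0 := fun i hi => hc i (by simp [hi])
    have hAS : ∑ i ∈ s, (c i : ℝ) ^ 2 + (c a : ℝ) ^ 2 ≤ S := by
      rw [Finset.sum_cons] at hS; linarith
    have hih := ih hcs (by nlinarith [sq_nonneg (c a : ℝ)])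
    set A := ∑ i ∈ s, (c i : ℝ) ^ 2 with hA
    set g : ℤ := s.gcd c with hgdef
    have hg : g ≠ 0 := by
      obtain ⟨i, his⟩ := hs
      intro h0
      exact hcs i his (Finset.gcd_eq_zero_iff.1 h0 i his)
    have hgpos : (0 : ℝ) < (g : ℝ) ^ 2 := by
      have : (g : ℝ) ≠ 0 := by exact_mod_cast hg
      positivity
    have hkA : (s.card : ℝ) * (g : ℝ) ^ 2 ≤ A := mul_gcd_sq_le_sum_sq s c hcs
    have hk1 : (1 : ℝ) ≤ s.card := by exact_mod_cast hs.card_pos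
    have hA0 : 0 < A := by nlinarith
    have hca : (0 : ℝ) < (c a : ℝ) ^ 2 := by
      have : (c a : ℝ) ≠ 0 := by exact_mod_cast ha
      positivity
    have ht : Real.exp (-(2 * Real.pi ^ 2 * (A * V * ((c a : ℝ) ^ 2 * V)) /
        ((A * V + (c a : ℝ) ^ 2 * V) * (Int.lcm g (c a) : ℝ) ^ 2))) ≤ y ^ s.card := by
      refine (Real.exp_le_exp.2 (neg_le_neg
        (smoothing_ratio_le hg ha hV hA0 hkA hAS))).trans ?_
      rw [← mul_neg, Real.exp_nat_mul]
      gcongr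
    have ht' : y ^ s.card ≤ 1 / 2 :=
      (pow_le_of_le_one hy0 (by linarith) hs.card_pos.ne').trans hy'
    have hstep := deficit_conv_latticeGaussian_le hg ha (mul_pos hA0 hV) (mul_pos hca hV) ht ht'
    have hind : IndepFun (∑ i ∈ s, fun ω => c i * e i ω) (fun ω => c a * e a ω) μ :=
      hi'.indepFun_finsetSum_of_notMem hm has
    have hms : Measurable (∑ i ∈ s, fun ω => c i * e i ω) := by
      rw [Finset.sum_fn]
      exact Finset.measurable_sum s fun i _ => hm i
    rw [Finset.sum_cons, Finset.sum_cons, add_comm, add_comm (fun ω => c a * e a ω),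
      law_add μ hms (hm a) hind, Finset.card_cons]
    have hgcd : (Finset.cons a s has).gcd c = (Int.gcd g (c a) : ℤ) := by
      classical
      rw [Finset.cons_eq_insert, Finset.gcd_insert, Int.coe_gcd, gcd_comm]
    rw [hgcd, ← hA, add_mul]
    have hsum : ENNReal.ofReal (∑ j ∈ Finset.range (s.card + 1 - 1), 8 * y ^ (j + 1)) =
        ENNReal.ofReal (∑ j ∈ Finset.range (s.card - 1), 8 * y ^ (j + 1)) +
          ENNReal.ofReal (8 * y ^ s.card) := by
      obtain ⟨k, hk⟩ := Nat.exists_eq_succ_of_ne_zero hs.card_pos.ne'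
      rw [← ENNReal.ofReal_add (Finset.sum_nonneg fun _ _ => by positivity) (by positivity), hk]
      simp only [Nat.succ_eq_add_one, Nat.add_sub_cancel]
      rw [Finset.sum_range_succ]
    rw [hsum]
    calc _ ≤ _ := deficit_triangle _ (conv (latticeGaussian g (A * V))
            (latticeGaussian (c a) ((c a : ℝ) ^ 2 * V))) _
      _ ≤ ENNReal.ofReal (8 * y ^ s.card) + (deficit (conv (latticeGaussian g (A * V))
            (latticeGaussian (c a) ((c a : ℝ) ^ 2 * V))) (conv (law μ (∑ i ∈ s, fun ω => c i * e i ω))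
            (latticeGaussian (c a) ((c a : ℝ) ^ 2 * V))) +
            deficit (conv (law μ (∑ i ∈ s, fun ω => c i * e i ω))
            (latticeGaussian (c a) ((c a : ℝ) ^ 2 * V)))
            (conv (law μ (∑ i ∈ s, fun ω => c i * e i ω)) (law μ fun ω => c a * e a ω))) :=
          add_le_add hstep (deficit_triangle _ _ _)
      _ ≤ ENNReal.ofReal (8 * y ^ s.card) + ((s.card * τ +
            ENNReal.ofReal (∑ j ∈ Finset.range (s.card - 1), 8 * y ^ (j + 1))) + τ) := by
          gcongr
          · refine (deficit_conv_right _ _ _).trans ?_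
            rw [tsum_latticeGaussian ha (mul_pos hca hV), mul_one]
            exact hih
          · refine (deficit_conv_left _ _ _).trans ?_
            rw [tsum_law μ hms, one_mul, deficit_latticeGaussian_law_mul μ ha hV]
            exact hτ a
      _ = _ := by push_cast; ring

/-! ### Truncation to `Zq` and Gaussian tails -/

/-- The mass that the discrete Gaussian on `ℤ` puts outside `ℤ_q`. -/
noncomputable def tailMass (q : ℕ) (V : ℝ) : ℝ≥0∞ :=
  ∑' z, if z ∈ Zq q then 0 else latticeGaussian 1 V z

theorem mem_Zq {q : ℕ} {z : ℤ} : z ∈ Zq q ↔ -(q : ℤ) ≤ 2 * z ∧ 2 * z < q := by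
  simp only [Zq, Finset.mem_filter, Finset.mem_Icc]
  omega

theorem sum_Zq_exp_pos {q : ℕ} (hq : 0 < q) (V : ℝ) :
    0 < ∑ y ∈ Zq q, Real.exp (-((y : ℝ) - 0) ^ 2 / (2 * V)) :=
  Finset.sum_pos (fun _ _ => Real.exp_pos _) ⟨0, mem_Zq.2 (by omega)⟩

theorem sum_Zq_exp_le (q : ℕ) {V : ℝ} (hV : 0 < V) :
    ∑ y ∈ Zq q, Real.exp (-((y : ℝ) - 0) ^ 2 / (2 * V)) ≤ gaussianSum (1 / (2 * V)) 0 := by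
  have h : ∀ y : ℤ, Real.exp (-((y : ℝ) - 0) ^ 2 / (2 * V)) =
      Real.exp (-(1 / (2 * V)) * ((y : ℝ) + 0) ^ 2) := by
    intro y; congr 1; ring
  simp only [h]
  exact (summable_exp_neg_mul_sq_add (by positivity) 0).sum_le_tsum _
    fun _ _ => (Real.exp_pos _).le

theorem discreteNormal_nonneg {q : ℕ} (hq : 0 < q) (V : ℝ) (x : ℤ) :
    0 ≤ discreteNormal (Zq q) 0 V x := by
  unfold discreteNormal
  split_ifs
  · exact div_nonneg (Real.exp_pos _).le (sum_Zq_exp_pos hq V).le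
  · exact le_rfl

theorem sum_discreteNormal {q : ℕ} (hq : 0 < q) (V : ℝ) :
    ∑ x ∈ Zq q, discreteNormal (Zq q) 0 V x = 1 := by
  unfold discreteNormal
  rw [Finset.sum_congr rfl fun x hx => if_pos hx, ← Finset.sum_div]
  exact div_self (sum_Zq_exp_pos hq V).ne'

theorem tsum_ofReal_discreteNormal {q : ℕ} (hq : 0 < q) (V : ℝ) :
    ∑' x, ENNReal.ofReal (discreteNormal (Zq q) 0 V x) = 1 := by
  rw [tsum_eq_sum (s := Zq q) (fun x hx => by simp [discreteNormal, hx]),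
    ← ENNReal.ofReal_sum_of_nonneg fun x _ => discreteNormal_nonneg hq V x, sum_discreteNormal hq,
    ENNReal.ofReal_one]

theorem latticeGaussian_one_eq {V : ℝ} (hV : 0 < V) (z : ℤ) :
    latticeGaussian 1 V z =
      ENNReal.ofReal (Real.exp (-(z : ℝ) ^ 2 / (2 * V)) / gaussianSum (1 / (2 * V)) 0) := by
  rw [latticeGaussian, tsum_latticeWeight one_ne_zero hV, latticeWeight, if_pos (one_dvd _),
    ENNReal.ofReal_div_of_pos (gaussianSum_zero_pos (by positivity)), Int.cast_one, one_pow]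

/-- Inside `Zq` the truncated law has the smaller normaliser and hence the larger mass, so the
excess lives outside. -/
theorem deficit_latticeGaussian_discreteNormal_le {q : ℕ} (hq : 0 < q) {V : ℝ} (hV : 0 < V) :
    deficit (latticeGaussian 1 V) (fun x => ENNReal.ofReal (discreteNormal (Zq q) 0 V x)) ≤
      tailMass q V := by
  refine ENNReal.tsum_le_tsum fun z => ?_
  split_ifs with hz
  · rw [nonpos_iff_eq_zero, tsub_eq_zero_iff_le, latticeGaussian_one_eq hV]
    apply ENNReal.ofReal_le_ofReal
    rw [discreteNormal, if_pos hz]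
    simp only [sub_zero]
    gcongr
    · simpa using sum_Zq_exp_pos hq V
    · simpa using sum_Zq_exp_le q hV
  · exact tsub_le_self

/-- With `m = ⌈q / 2⌉`, `(m + j)² ≥ q² / 4 + q j` gives a geometric series of ratio `exp (-β q)`. -/
theorem tsum_exp_neg_sq_ge_le {β : ℝ} (hβ : 0 < β) {q : ℕ} (hq : 0 < q) :
    (∑' z : ℤ, if (q : ℤ) ≤ 2 * z then ENNReal.ofReal (Real.exp (-β * (z : ℝ) ^ 2)) else 0) ≤
      ENNReal.ofReal (Real.exp (-β * q ^ 2 / 4) * (1 + 1 / (β * q))) := by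
  have hq' : (0 : ℝ) < q := by exact_mod_cast hq
  set m : ℕ := (q + 1) / 2 with hm
  have hm2 : (q : ℝ) ≤ 2 * m := by
    have : q ≤ 2 * m := by omega
    exact_mod_cast this
  have hinj : Function.Injective fun j : ℕ => (m : ℤ) + j := fun i j h => by simpa using h
  rw [← hinj.tsum_eq]
  · set x := β * q with hx
    have hx0 : 0 < x := by positivity
    have h1 : Real.exp (-x) < 1 := by rw [Real.exp_lt_one_iff]; linarith
    have hgeo : HasSum (fun n : ℕ => Real.exp (-β * q ^ 2 / 4) * Real.exp (-x) ^ n)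
        (Real.exp (-β * q ^ 2 / 4) * (1 - Real.exp (-x))⁻¹) :=
      (hasSum_geometric_of_lt_one (Real.exp_pos _).le h1).mul_left _
    have h2 : (1 - Real.exp (-x))⁻¹ ≤ 1 + 1 / x := by
      rw [inv_le_comm₀ (by linarith) (by positivity)]
      have h3 : Real.exp (-x) ≤ (1 + x)⁻¹ := by
        rw [Real.exp_neg]
        exact inv_anti₀ (by positivity) (by linarith [Real.add_one_le_exp x])
      have h4 : (1 + 1 / x)⁻¹ = 1 - (1 + x)⁻¹ := by field_simp; ring
      linarith
    calc _ ≤ ∑' n : ℕ, ENNReal.ofReal (Real.exp (-β * q ^ 2 / 4) * Real.exp (-x) ^ n) := by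
          refine ENNReal.tsum_le_tsum fun j => ?_
          split_ifs
          · apply ENNReal.ofReal_le_ofReal
            rw [← Real.exp_nat_mul, ← Real.exp_add]
            apply Real.exp_le_exp.2
            have hj : (0 : ℝ) ≤ j := Nat.cast_nonneg j
            have h5 : (q : ℝ) ^ 2 / 4 + q * j ≤ ((m : ℝ) + j) ^ 2 := by nlinarith
            push_cast
            rw [hx]
            nlinarith [mul_le_mul_of_nonneg_left h5 hβ.le]
          · exact zero_le
      _ = ENNReal.ofReal (Real.exp (-β * q ^ 2 / 4) * (1 - Real.exp (-x))⁻¹) := by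
          rw [← ENNReal.ofReal_tsum_of_nonneg (fun _ => by positivity) hgeo.summable, hgeo.tsum_eq]
      _ ≤ _ := by gcongr
  · intro z hz
    have hz' : (q : ℤ) ≤ 2 * z := by
      by_contra h
      simp [h] at hz
    exact ⟨(z - m).toNat, by simp only; omega⟩

theorem tailMass_sq_le {q : ℕ} (hq : 0 < q) {s : ℝ} (hs : 0 < s) :
    tailMass q (s ^ 2) ≤
      ENNReal.ofReal (2 * Real.exp (-(q : ℝ) ^ 2 / (8 * s ^ 2)) * (1 / s + 2 * s / q)) := by
  have hq' : (0 : ℝ) < q := by exact_mod_cast hq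
  set β := 1 / (2 * s ^ 2) with hβ
  have hβ0 : 0 < β := by positivity
  set F : ℤ → ℝ≥0∞ := fun z =>
    if (q : ℤ) ≤ 2 * z then ENNReal.ofReal (Real.exp (-β * (z : ℝ) ^ 2)) else 0 with hF
  have hG : s ≤ gaussianSum β 0 := by
    refine le_trans ?_ (sqrt_le_gaussianSum_zero hβ0)
    apply Real.le_sqrt_of_sq_le
    rw [hβ]
    have : Real.pi / (1 / (2 * s ^ 2)) = 2 * Real.pi * s ^ 2 := by field_simp
    rw [this]
    nlinarith [Real.pi_gt_three, sq_nonneg s]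
  have hterm : ∀ z : ℤ, (if z ∈ Zq q then 0 else latticeGaussian 1 (s ^ 2) z) ≤
      (F z + F (-z)) * ENNReal.ofReal (1 / s) := by
    intro z
    split_ifs with hz
    · exact zero_le
    · rw [latticeGaussian_one_eq (by positivity)]
      have hle : ENNReal.ofReal (Real.exp (-(z : ℝ) ^ 2 / (2 * s ^ 2)) / gaussianSum (1 / (2 * s ^ 2)) 0)
          ≤ ENNReal.ofReal (Real.exp (-β * (z : ℝ) ^ 2)) * ENNReal.ofReal (1 / s) := by
        rw [← ENNReal.ofReal_mul (Real.exp_pos _).le, ← div_eq_mul_one_div]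
        apply ENNReal.ofReal_le_ofReal
        have : -(z : ℝ) ^ 2 / (2 * s ^ 2) = -β * (z : ℝ) ^ 2 := by rw [hβ]; ring
        rw [this]
        gcongr
      refine hle.trans ?_
      gcongr
      rw [mem_Zq, not_and_or] at hz
      rcases hz with hz | hz
      · have : (q : ℤ) ≤ 2 * (-z) := by omega
        simp only [hF, this, if_true, Int.cast_neg, neg_sq]
        exact le_add_self
      · have : (q : ℤ) ≤ 2 * z := by omega
        simp only [hF, this, if_true]
        exact le_self_add
  calc tailMass q (s ^ 2) ≤ ∑' z, (F z + F (-z)) * ENNReal.ofReal (1 / s) :=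
        ENNReal.tsum_le_tsum hterm
    _ = (∑' z, F z + ∑' z, F z) * ENNReal.ofReal (1 / s) := by
        rw [ENNReal.tsum_mul_right, ENNReal.tsum_add]
        congr 2
        exact (Equiv.neg ℤ).tsum_eq F
    _ ≤ (ENNReal.ofReal (Real.exp (-β * q ^ 2 / 4) * (1 + 1 / (β * q))) +
          ENNReal.ofReal (Real.exp (-β * q ^ 2 / 4) * (1 + 1 / (β * q)))) *
          ENNReal.ofReal (1 / s) := by
        gcongr <;> exact tsum_exp_neg_sq_ge_le hβ0 hq
    _ = _ := by
        rw [← ENNReal.ofReal_add (by positivity) (by positivity), ← ENNReal.ofReal_mul (by positivity)]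
        congr 1
        have : -β * (q : ℝ) ^ 2 / 4 = -(q : ℝ) ^ 2 / (8 * s ^ 2) := by rw [hβ]; field_simp; norm_num
        rw [this, hβ]
        field_simp
        ring

/-! ### Tail masses against the overflow probability -/

/-- About `σ² / (8 T)` integers just beyond the threshold `T = q / (2 R)` still carry density
comparable to that at `T`, up to `exp (-4)`. -/
theorem le_overflowProb {q : ℕ} (hq : 0 < q) {σ R T : ℝ} (hR : 0 < R) (hR2 : 2 ≤ R ^ 2)
    (hT : R * T = q / 2) (hσ : 4 ≤ σ) (hσT : σ < T) (hT2 : T ≤ 2 * σ ^ 2) :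
    σ / (64 * T) * Real.exp (-4) * Real.exp (-T ^ 2 / (2 * σ ^ 2)) ≤ overflowProb q (σ ^ 2) R := by
  have hσ0 : 0 < σ := by linarith
  have hT0 : 0 < T := by linarith
  have hR1 : 1.4 ≤ R := by nlinarith
  set f : ℕ := ⌊T⌋₊ with hf
  have hf1 : (f : ℝ) ≤ T := Nat.floor_le hT0.le
  have hf2 : T < f + 1 := Nat.lt_floor_add_one T
  set M : ℕ := ⌈σ ^ 2 / (8 * T)⌉₊ with hM
  have hM1 : σ ^ 2 / (8 * T) ≤ M := Nat.le_ceil _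
  have hM2 : (M : ℝ) < σ ^ 2 / (8 * T) + 1 := Nat.ceil_lt_add_one (by positivity)
  have hσ8 : σ ^ 2 / (8 * T) ≤ T / 8 := by
    rw [div_le_iff₀ (by positivity)]; nlinarith
  have hMT : (M : ℝ) ≤ 0.375 * T := by nlinarith
  set D := ∑ y ∈ Zq q, Real.exp (-((y : ℝ) - 0) ^ 2 / (2 * σ ^ 2)) with hD
  have hD0 : 0 < D := sum_Zq_exp_pos hq _
  have hD8 : D ≤ 8 * σ := by
    have hpi := Real.pi_gt_three
    have hpi2 := Real.pi_lt_d2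
    refine (sum_Zq_exp_le q (by positivity)).trans ?_
    have hexp : Real.exp (-(Real.pi ^ 2 / (1 / (2 * σ ^ 2)))) ≤ 1 / 2 := by
      have h1 : Real.pi ^ 2 / (1 / (2 * σ ^ 2)) = 2 * Real.pi ^ 2 * σ ^ 2 := by field_simp
      have h2 : 1 ≤ 2 * Real.pi ^ 2 * σ ^ 2 := by nlinarith [mul_pos hσ0 hσ0]
      rw [h1, Real.exp_neg, one_div]
      refine inv_anti₀ (by norm_num) ?_
      linarith [Real.add_one_le_exp (2 * Real.pi ^ 2 * σ ^ 2)]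
    refine (gaussianSum_zero_le (by positivity) hexp le_rfl).trans ?_
    have h3 : Real.sqrt (Real.pi / (1 / (2 * σ ^ 2))) ≤ 2.6 * σ := by
      apply Real.sqrt_le_iff.2 ⟨by positivity, ?_⟩
      have h1 : Real.pi / (1 / (2 * σ ^ 2)) = 2 * Real.pi * σ ^ 2 := by field_simp
      rw [h1]; nlinarith [mul_pos hσ0 hσ0]
    linarith
  -- Negative points, because `Zq` contains `-q / 2` when `q` is even but never `q / 2`. They fit
  -- since `T + M ≤ 1.375 T` and `1.4 ≤ R`.
  set p : ℕ → ℤ := fun j => -((f : ℤ) + 1 + j) with hp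
  have hpinj : Function.Injective p := fun i j h => by simpa [hp] using h
  have habs : ∀ j : ℕ, |(p j : ℝ)| = f + 1 + j := by
    intro j
    simp only [hp, Int.cast_neg, abs_neg]
    push_cast
    exact abs_of_nonneg (by positivity)
  have hjM : ∀ j ∈ Finset.range M, (f : ℝ) + 1 + j ≤ T + M := by
    intro j hj
    have : (j : ℝ) + 1 ≤ M := by exact_mod_cast Finset.mem_range.1 hj
    linarith
  have hmem : ∀ j ∈ Finset.range M, p j ∈ Zq q := by
    intro j hj
    rw [mem_Zq]
    have h1 := hjM j hj
    have h2 : 2 * ((f : ℝ) + 1 + j) ≤ q := by nlinarith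
    have h3 : 2 * ((f : ℤ) + 1 + j) ≤ q := by exact_mod_cast h2
    simp only [hp]
    omega
  have hsub : (Finset.range M).image p ⊆
      (Zq q).filter (fun x : ℤ => (q : ℝ) / 2 < R * |(x : ℝ)|) := by
    intro x hx
    obtain ⟨j, hj, rfl⟩ := Finset.mem_image.1 hx
    refine Finset.mem_filter.2 ⟨hmem j hj, ?_⟩
    rw [habs, ← hT]
    have : (0 : ℝ) ≤ j := Nat.cast_nonneg j
    exact mul_lt_mul_of_pos_left (by linarith) hR
  set v := Real.exp (-4) * Real.exp (-T ^ 2 / (2 * σ ^ 2)) / (8 * σ) with hv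
  have hval : ∀ x ∈ (Finset.range M).image p, v ≤ discreteNormal (Zq q) 0 (σ ^ 2) x := by
    intro x hx
    obtain ⟨j, hj, rfl⟩ := Finset.mem_image.1 hx
    rw [discreteNormal, if_pos (hmem j hj), ← hD, hv, ← Real.exp_add]
    gcongr
    have hsq : ((p j : ℝ) - 0) ^ 2 ≤ (T + M) ^ 2 := by
      rw [sub_zero, ← sq_abs, habs]
      have := hjM j hj
      gcongr
    have hbd : (T + M) ^ 2 ≤ T ^ 2 + 8 * σ ^ 2 := by
      have h1 : T * M ≤ σ ^ 2 / 8 + T := by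
        have h2 : T * (σ ^ 2 / (8 * T)) = σ ^ 2 / 8 := by field_simp
        nlinarith
      nlinarith
    have : -4 + -T ^ 2 / (2 * σ ^ 2) = -(T ^ 2 + 8 * σ ^ 2) / (2 * σ ^ 2) := by
      field_simp; ring
    rw [this]
    gcongr
    linarith
  calc _ = σ ^ 2 / (8 * T) * v := by rw [hv]; field_simp; norm_num
    _ ≤ M * v := by gcongr
    _ = ((Finset.range M).image p).card • v := by
        rw [Finset.card_image_of_injective _ hpinj, Finset.card_range, nsmul_eq_mul]
    _ ≤ ∑ x ∈ (Finset.range M).image p, discreteNormal (Zq q) 0 (σ ^ 2) x :=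
        Finset.card_nsmul_le_sum _ _ _ hval
    _ ≤ _ := Finset.sum_le_sum_of_subset_of_nonneg hsub fun x _ _ => discreteNormal_nonneg hq _ x

/-- For `T ≤ 2 σ²` the overflow bound applies, and `1 / σ ≤ 2 σ / T` gives the constant `192 = 3 ·
64`. For larger `T` the exponential is at most `exp (-2 σ²)`, already below the smoothing error
since `π / R² ≤ 2`. -/
theorem exp_mul_le_of_overflowProb_le {q : ℕ} (hq : 0 < q) {σ R T κ ε : ℝ} (hR : 0 < R)
    (hR2 : 2 ≤ R ^ 2) (hT : R * T = q / 2) (hσ : 4 ≤ σ) (hσT : σ < T) (hε : 0 < ε)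
    (hy : Real.exp (-(Real.pi * σ ^ 2 / R ^ 2)) ≤ ε / 2) (hκ : overflowProb q (σ ^ 2) R ≤ κ * ε) :
    Real.exp (-T ^ 2 / (2 * σ ^ 2)) * (1 / σ + σ / T) ≤ (1 + 192 * Real.exp 4 * κ) * ε := by
  have hσ0 : 0 < σ := by linarith
  have hT0 : 0 < T := by linarith
  have hκ0 : 0 ≤ κ := by
    have : 0 ≤ overflowProb q (σ ^ 2) R := Finset.sum_nonneg fun x _ => discreteNormal_nonneg hq _ x
    exact nonneg_of_mul_nonneg_left (this.trans hκ) hε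
  set E := Real.exp (-T ^ 2 / (2 * σ ^ 2)) with hE
  have hE0 : 0 < E := Real.exp_pos _
  rcases le_total T (2 * σ ^ 2) with hTσ | hTσ
  · have h1 := (le_overflowProb hq hR hR2 hT hσ hσT hTσ).trans hκ
    rw [Real.exp_neg] at h1
    have h4 := Real.exp_pos 4
    have h2 : E * (σ / T) ≤ 64 * Real.exp 4 * (κ * ε) := by
      calc E * (σ / T) = 64 * Real.exp 4 * (σ / (64 * T) * (Real.exp 4)⁻¹ * E) := by
            field_simp
        _ ≤ _ := by gcongr
    have h3 : 1 / σ ≤ 2 * (σ / T) := by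
      rw [← mul_div_assoc, div_le_div_iff₀ hσ0 hT0]; nlinarith
    have h5 : E * (1 / σ + σ / T) ≤ E * (3 * (σ / T)) := by
      gcongr; linarith
    linarith
  · have h1 : E ≤ ε / 2 := by
      refine le_trans (Real.exp_le_exp.2 ?_) hy
      have h5 : Real.pi * σ ^ 2 / R ^ 2 ≤ 2 * σ ^ 2 := by
        rw [div_le_iff₀ (by positivity)]
        nlinarith [Real.pi_lt_four, mul_pos hσ0 hσ0]
      have h6 : 2 * σ ^ 2 ≤ T ^ 2 / (2 * σ ^ 2) := by
        rw [le_div_iff₀ (by positivity)]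
        nlinarith [mul_pos hσ0 hσ0]
      rw [neg_div]
      linarith
    have h2 : 1 / σ + σ / T ≤ 2 := by
      have h3 : 1 / σ ≤ 1 := by rw [div_le_one hσ0]; linarith
      have h4 : σ / T ≤ 1 := by rw [div_le_one hT0]; linarith
      linarith
    have h3 : 0 ≤ 192 * Real.exp 4 * κ * ε := by positivity
    have h4 : E * (1 / σ + σ / T) ≤ ε / 2 * 2 := by gcongr
    linarith

theorem tailMass_mul_sq_le {q : ℕ} (hq : 0 < q) {σ R T : ℝ} (hR1 : 1 ≤ R)
    (hT : R * T = q / 2) (hσ0 : 0 < σ) (hT0 : 0 < T) :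
    tailMass q ((R * σ) ^ 2) ≤
      ENNReal.ofReal (2 * (Real.exp (-T ^ 2 / (2 * σ ^ 2)) * (1 / σ + σ / T))) := by
  have hqT : (q : ℝ) = 2 * (R * T) := by rw [hT]; ring
  have hR : 0 < R := by linarith
  refine (tailMass_sq_le hq (mul_pos hR hσ0)).trans (ENNReal.ofReal_le_ofReal ?_)
  have e1 : -(q : ℝ) ^ 2 / (8 * (R * σ) ^ 2) = -T ^ 2 / (2 * σ ^ 2) := by
    rw [hqT]; field_simp; norm_num
  have e2 : 1 / (R * σ) + 2 * (R * σ) / q ≤ 1 / σ + σ / T := by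
    have : 2 * (R * σ) / q = σ / T := by rw [hqT]; field_simp
    rw [this]
    gcongr
    exact le_mul_of_one_le_left hσ0.le hR1
  rw [e1, mul_assoc]
  gcongr

/-- A single error must reach `R T`, not just `T`; the extra decay `exp (-D)` with `D ≥ (R² - 1) /
2` absorbs the factor `R²`. -/
theorem sq_mul_tailMass_le {q : ℕ} (hq : 0 < q) {σ R T : ℝ} (hR1 : 1 ≤ R)
    (hT : R * T = q / 2) (hσ0 : 0 < σ) (hσT : σ < T) :
    ENNReal.ofReal (R ^ 2) * tailMass q (σ ^ 2) ≤
      ENNReal.ofReal (4 * (Real.exp (-T ^ 2 / (2 * σ ^ 2)) * (1 / σ + σ / T))) := by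
  have hqT : (q : ℝ) = 2 * (R * T) := by rw [hT]; ring
  have hR : 0 < R := by linarith
  have hT0 : 0 < T := by linarith
  refine (mul_le_mul_right (tailMass_sq_le hq hσ0) _).trans ?_
  rw [← ENNReal.ofReal_mul (by positivity)]
  apply ENNReal.ofReal_le_ofReal
  set D := (R ^ 2 - 1) * (T ^ 2 / (2 * σ ^ 2)) with hD
  have e1 : -(q : ℝ) ^ 2 / (8 * σ ^ 2) = -T ^ 2 / (2 * σ ^ 2) + -D := by
    rw [hqT, hD]; field_simp; ring
  have e2 : 1 / σ + 2 * σ / q ≤ 1 / σ + σ / T := by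
    have : 2 * σ / q = σ / (R * T) := by rw [hqT]; field_simp
    rw [this]
    gcongr
    exact le_mul_of_one_le_left hT0.le hR1
  have e3 : (R ^ 2 - 1) / 2 ≤ D := by
    have h1 : 1 / 2 ≤ T ^ 2 / (2 * σ ^ 2) := by
      rw [div_le_div_iff₀ (by norm_num) (by positivity)]; nlinarith
    have h2 : 0 ≤ R ^ 2 - 1 := by nlinarith
    have := mul_le_mul_of_nonneg_left h1 h2
    linarith
  have e4 : R ^ 2 * Real.exp (-D) ≤ 2 := by
    rw [Real.exp_neg, ← div_eq_mul_inv, div_le_iff₀ (Real.exp_pos _)]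
    linarith [Real.add_one_le_exp D]
  rw [e1, Real.exp_add]
  set E := Real.exp (-T ^ 2 / (2 * σ ^ 2))
  have hE : 0 ≤ E := (Real.exp_pos _).le
  have hq' : (0 : ℝ) < q := by exact_mod_cast hq
  calc _ = 2 * E * (R ^ 2 * Real.exp (-D)) * (1 / σ + 2 * σ / q) := by ring
    _ ≤ 2 * E * 2 * (1 / σ + σ / T) := by gcongr
    _ = _ := by ring

/-- Both truncation errors are controlled by the overflow probability and the smoothing error. -/
theorem tailMass_bounds {q : ℕ} (hq : 0 < q) {σ R κ ε : ℝ} (hR : 0 < R) (hR2 : 2 ≤ R ^ 2)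
    (hσ : 4 ≤ σ) (hσq : σ ^ 2 < q ^ 2 / 4 / R ^ 2) (hε : 0 < ε)
    (hy : Real.exp (-(Real.pi * σ ^ 2 / R ^ 2)) ≤ ε / 2) (hκ : overflowProb q (σ ^ 2) R ≤ κ * ε) :
    ENNReal.ofReal (R ^ 2) * tailMass q (σ ^ 2) + tailMass q ((R * σ) ^ 2) ≤
      ENNReal.ofReal (6 * (1 + 192 * Real.exp 4 * κ) * ε) := by
  have hq' : (0 : ℝ) < q := by exact_mod_cast hq
  have hσ0 : 0 < σ := by linarith
  have hR1 : 1 ≤ R := by nlinarith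
  obtain ⟨T, hTdef⟩ : ∃ T : ℝ, T = q / (2 * R) := ⟨_, rfl⟩
  have hT : R * T = q / 2 := by rw [hTdef]; field_simp
  have hT0 : 0 < T := by rw [hTdef]; positivity
  have hσT : σ < T := by
    refine lt_of_pow_lt_pow_left₀ 2 hT0.le ?_
    have : T ^ 2 = q ^ 2 / 4 / R ^ 2 := by rw [hTdef]; field_simp; norm_num
    rwa [this]
  have hEh := exp_mul_le_of_overflowProb_le hq hR hR2 hT hσ hσT hε hy hκ
  refine (add_le_add (sq_mul_tailMass_le hq hR1 hT hσ0 hσT)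
    (tailMass_mul_sq_le hq hR1 hT hσ0 hT0)).trans ?_
  rw [← ENNReal.ofReal_add (by positivity) (by positivity)]
  apply ENNReal.ofReal_le_ofReal
  linarith

/-! ### The smoothing parameter of `ℤ` -/

theorem mem_intLattice {x : ℝ} : x ∈ intLattice ↔ ∃ k : ℤ, (k : ℝ) = x := by
  simp [intLattice, Submodule.mem_span_singleton]

theorem mem_dualLattice_intLattice {w : ℝ} : w ∈ dualLattice intLattice ↔ ∃ k : ℤ, (k : ℝ) = w := by
  have h1 : (1 : ℝ) ∈ intLattice := mem_intLattice.2 ⟨1, by simp⟩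
  constructor
  · rintro ⟨-, h⟩
    obtain ⟨k, hk⟩ := h 1 h1
    exact ⟨k, by simpa [eq_comm] using hk⟩
  · rintro ⟨k, rfl⟩
    refine ⟨?_, fun x hx => ?_⟩
    · have := Submodule.smul_mem _ (k : ℝ) (Submodule.subset_span (R := ℝ) (s := (intLattice : Set ℝ)) h1)
      simpa using this
    · obtain ⟨j, rfl⟩ := mem_intLattice.1 hx
      exact ⟨k * j, by simp [mul_comm]⟩

theorem dual_gaussian_mass_le {t : ℝ} (ht : 0 < t) {y : ℝ}
    (hy : Real.exp (-(Real.pi * t ^ 2)) ≤ y) (hy' : y ≤ 1 / 2) :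
    ∑' w : {w : ℝ // w ∈ dualLattice intLattice ∧ w ≠ 0},
      ENNReal.ofReal (Real.exp (-Real.pi * t ^ 2 * ‖(w : ℝ)‖ ^ 2)) ≤ ENNReal.ofReal (4 * y) := by
  have hr : 0 < Real.pi * t ^ 2 := by have := Real.pi_pos; positivity
  have hs := summable_exp_neg_mul_int_sq hr
  have key := tsum_exp_neg_mul_int_sq_le hr hy hy'
  rw [hs.tsum_eq_add_tsum_ite 0] at key
  simp only [Int.cast_zero, ne_eq, OfNat.ofNat_ne_zero, not_false_eq_true, zero_pow, mul_zero,
    Real.exp_zero, add_le_add_iff_left] at key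
  choose k hk using fun w : {w : ℝ // w ∈ dualLattice intLattice ∧ w ≠ 0} =>
    mem_dualLattice_intLattice.1 w.2.1
  have hinj : Function.Injective k := fun v w h => Subtype.ext (by rw [← hk v, ← hk w, h])
  have hk0 : ∀ w, k w ≠ 0 := fun w h => w.2.2 (by rw [← hk w, h, Int.cast_zero])
  refine le_trans ?_ (ENNReal.ofReal_le_ofReal key)
  rw [ENNReal.ofReal_tsum_of_nonneg]
  · refine le_trans (le_of_eq ?_) (ENNReal.tsum_comp_le_tsum_of_injective hinj _)
    refine tsum_congr fun w => ?_
    rw [if_neg (hk0 w), ← hk w, Real.norm_eq_abs, sq_abs, neg_mul]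
  · intro n; split_ifs <;> positivity
  · refine Summable.of_nonneg_of_le (fun n => ?_) (fun n => ?_) hs
    · split_ifs <;> positivity
    · split_ifs
      · positivity
      · exact le_rfl

theorem exp_smoothingParameter_intLattice_le {ε : ℝ} (hε : 0 < ε) (hε1 : ε < 1) :
    Real.exp (-(Real.pi * smoothingParameter intLattice ε ^ 2)) ≤ ε / 2 := by
  have hpi := Real.pi_pos
  have hlog : ∀ a : ℝ, 1 < a → 0 < Real.log (a / ε) := fun a ha =>
    Real.log_pos (by rw [lt_div_iff₀ hε]; linarith)
  have hexp : ∀ a : ℝ, 1 < a →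
      Real.exp (-(Real.pi * Real.sqrt (Real.log (a / ε) / Real.pi) ^ 2)) = ε / a := by
    intro a ha
    rw [Real.sq_sqrt (div_pos (hlog a ha) hpi).le, mul_div_cancel₀ _ hpi.ne', Real.exp_neg,
      Real.exp_log (by positivity), inv_div]
  have hle : Real.sqrt (Real.log (2 / ε) / Real.pi) ≤ smoothingParameter intLattice ε := by
    -- A member of the set is needed because `sInf ∅ = 0`. The lower bound comes from the dual
    -- vectors `±1` alone, which force `2 exp (-π t²) ≤ ε`.
    refine le_csInf ⟨Real.sqrt (Real.log (4 / ε) / Real.pi), ?_, ?_⟩ ?_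
    · exact Real.sqrt_pos.2 (div_pos (hlog 4 (by norm_num)) hpi)
    · refine (dual_gaussian_mass_le
        (Real.sqrt_pos.2 (div_pos (hlog 4 (by norm_num)) hpi)) (hexp 4 (by norm_num)).le
        (by linarith)).trans_eq ?_
      congr 1; ring
    · rintro t ⟨ht0, ht⟩
      have hmem : ∀ k : ℤ, k ≠ 0 → (k : ℝ) ∈ dualLattice intLattice ∧ (k : ℝ) ≠ 0 := fun k hk =>
        ⟨mem_dualLattice_intLattice.2 ⟨k, rfl⟩, by exact_mod_cast hk⟩
      let u : {w : ℝ // w ∈ dualLattice intLattice ∧ w ≠ 0} := ⟨_, hmem 1 (by norm_num)⟩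
      let v : {w : ℝ // w ∈ dualLattice intLattice ∧ w ≠ 0} := ⟨_, hmem (-1) (by norm_num)⟩
      have huv : u ≠ v := by
        intro h
        have := congrArg Subtype.val h
        norm_num [u, v] at this
      have h2 := (ENNReal.sum_le_tsum {u, v}).trans ht
      rw [Finset.sum_pair huv] at h2
      simp only [u, v, Int.cast_one, Int.cast_neg, norm_neg, norm_one, one_pow, mul_one] at h2
      rw [← ENNReal.ofReal_add (Real.exp_pos _).le (Real.exp_pos _).le,
        ENNReal.ofReal_le_ofReal_iff hε.le] at h2
      apply Real.sqrt_le_iff.2 ⟨ht0.le, ?_⟩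
      rw [div_le_iff₀ hpi, Real.log_le_iff_le_exp (by positivity)]
      have h3 : Real.exp (-Real.pi * t ^ 2) = (Real.exp (t ^ 2 * Real.pi))⁻¹ := by
        rw [← Real.exp_neg]; congr 1; ring
      have h4 := Real.exp_pos (t ^ 2 * Real.pi)
      rw [h3] at h2
      rw [div_le_iff₀ hε]
      have h5 : (Real.exp (t ^ 2 * Real.pi))⁻¹ ≤ ε / 2 := by linarith
      rw [inv_le_iff_one_le_mul₀ h4] at h5
      linarith
  rw [← hexp 2 (by norm_num)]
  have h0 := Real.sqrt_nonneg (Real.log (2 / ε) / Real.pi)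
  gcongr

/-! ### Modular algebra of the filtered residual -/

theorem bmod_mem_Zq {q : ℕ} (hq : 0 < q) (x : ℤ) : Int.bmod x q ∈ Zq q := by
  have h1 := Int.le_bmod (x := x) hq
  have h2 := Int.bmod_lt (x := x) hq
  rw [mem_Zq]
  omega

theorem bmod_eq_self_of_mem_Zq {q : ℕ} {x : ℤ} (hx : x ∈ Zq q) : Int.bmod x q = x := by
  rw [mem_Zq] at hx
  exact Int.bmod_eq_of_le_mul_two (by omega) (by omega)

theorem intCast_bmod (q : ℕ) (x : ℤ) : ((Int.bmod x q : ℤ) : ZMod q) = x := by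
  rw [← sub_eq_zero, ← Int.cast_sub, ZMod.intCast_zmod_eq_zero_iff_dvd]
  exact Int.dvd_bmod_sub_self

theorem bmod_eq_bmod_iff_intCast_eq {q : ℕ} {x y : ℤ} :
    Int.bmod x q = Int.bmod y q ↔ (x : ZMod q) = y := by
  rw [Int.bmod_eq_bmod_iff_bmod_sub_eq_zero, ← Int.dvd_iff_bmod_eq_zero,
    ← ZMod.intCast_zmod_eq_zero_iff_dvd, Int.cast_sub, sub_eq_zero]

theorem filtered_fst_eq_zero {q n N v : ℕ} {r : ℤ} {T : Matrix (Fin N) (Fin n) ℤ}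
    {P : Matrix (Fin n) (Fin v) ℤ} {d : Fin N → ℤ}
    (hd : d ∈ qKer q (publicColumns (linComb q T (P, 0)))) (s : Fin v → ℤ) (m e : Fin n → ℤ) :
    (filtered q d (linComb q T (lweEnc q r P s m e))).1 = 0 := by
  ext j
  have := hd.2 j
  rw [publicColumns, Matrix.mulVec_transpose] at this
  exact this

/-- Under the null hypothesis only the combined noise survives the filtering. -/
theorem filtered_snd_eq {q n N v : ℕ} {r : ℤ} {T : Matrix (Fin N) (Fin n) ℤ}
    {P : Matrix (Fin n) (Fin v) ℤ} {d : Fin N → ℤ}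
    (hd : d ∈ qKer q (publicColumns (linComb q T (P, 0)))) (s : Fin v → ℤ) (m e : Fin n → ℤ)
    (hm : ∀ k, Int.bmod (T.mulVec m k) q = 0) :
    (filtered q d (linComb q T (lweEnc q r P s m e))).2 =
      Int.bmod (∑ i, T.transpose.mulVec d i * e i) q := by
  let φ : ℤ →+* ZMod q := Int.castRingHom (ZMod q)
  have hφ : ∀ x : ℤ, ((x : ℤ) : ZMod q) = φ x := fun x => rfl
  have hb : ∀ x : ℤ, φ (Int.bmod x q) = φ x := intCast_bmod q
  have hPd : Matrix.vecMul (φ ∘ d) (T.map φ * P.map φ) = 0 := by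
    ext j
    have h1 := congrArg φ (hd.2 j)
    rw [map_zero, hb, publicColumns, Matrix.mulVec_transpose, RingHom.map_vecMul] at h1
    rw [Pi.zero_apply, ← h1, ← Matrix.map_mul]
    congr 1
    ext i j
    exact (hb _).symm
  have hTm : T.map φ *ᵥ (φ ∘ m) = 0 := by
    ext k
    have h1 := congrArg φ (hm k)
    rw [map_zero, hb, RingHom.map_mulVec] at h1
    exact h1
  have hx : (φ ∘ fun i => Int.bmod (P.mulVec s i + m i * r + e i) q) =
      P.map φ *ᵥ (φ ∘ s) + φ r • (φ ∘ m) + φ ∘ e := by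
    ext i
    simp only [Function.comp_apply, hb, map_add, map_mul, RingHom.map_mulVec, Pi.add_apply,
      Pi.smul_apply, smul_eq_mul]
    ring
  have hy : (φ ∘ (linComb q T (lweEnc q r P s m e)).2) =
      T.map φ *ᵥ (P.map φ *ᵥ (φ ∘ s) + φ r • (φ ∘ m) + φ ∘ e) := by
    ext k
    simp only [linComb, lweEnc, Function.comp_apply, hb]
    rw [RingHom.map_mulVec, hx]
  simp only [filtered]
  rw [bmod_eq_bmod_iff_intCast_eq, hφ, hφ, RingHom.map_dotProduct, hy]
  have hc : ∑ i, T.transpose.mulVec d i * e i = T.transpose.mulVec d ⬝ᵥ e := rfl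
  rw [hc, RingHom.map_dotProduct]
  have hcd : (φ ∘ T.transpose.mulVec d) = Matrix.vecMul (φ ∘ d) (T.map φ) := by
    ext i
    rw [Function.comp_apply, Matrix.mulVec_transpose, RingHom.map_vecMul]
  rw [hcd, Matrix.mulVec_add, Matrix.mulVec_add, Matrix.mulVec_smul, hTm, smul_zero, add_zero,
    Matrix.mulVec_mulVec, dotProduct_add, Matrix.dotProduct_mulVec, hPd, zero_dotProduct, zero_add,
    Matrix.dotProduct_mulVec]

theorem quadForm_residualCov {n N : ℕ} (σ : ℝ) (T : Matrix (Fin N) (Fin n) ℤ) (d : Fin N → ℤ) :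
    quadForm (residualCov σ T) d = (∑ i, (T.transpose.mulVec d i : ℝ) ^ 2) * σ ^ 2 := by
  set T' : Matrix (Fin N) (Fin n) ℝ := T.map (Int.cast : ℤ → ℝ)
  set d' : Fin N → ℝ := fun k => (d k : ℝ)
  have hc : ∀ i, ((T.transpose.mulVec d i : ℤ) : ℝ) = Matrix.vecMul d' T' i := by
    intro i
    rw [Matrix.mulVec_transpose]
    exact RingHom.map_vecMul (Int.castRingHom ℝ) T d i
  have h : ∑ i, (T.transpose.mulVec d i : ℝ) ^ 2 = Matrix.vecMul d' T' ⬝ᵥ Matrix.vecMul d' T' := by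
    simp only [hc, dotProduct, sq]
  rw [h]
  unfold quadForm residualCov
  rw [Matrix.smul_mulVec, dotProduct_smul, ← Matrix.mulVec_mulVec, Matrix.dotProduct_mulVec,
    Matrix.mulVec_transpose, smul_eq_mul, mul_comm]

theorem l2norm_sq {n : ℕ} (x : Fin n → ℤ) : l2norm x ^ 2 = ∑ i, (x i : ℝ) ^ 2 :=
  Real.sq_sqrt (Finset.sum_nonneg fun _ _ => sq_nonneg _)

/-! ### From one-sided deficit to statistical distance and events -/

section Comparison

variable {S : Finset ℤ} {f g : ℤ → ℝ} {δ : ℝ}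

theorem sum_max_sub_le (hf : ∀ x, 0 ≤ f x) (hδ : 0 ≤ δ)
    (h : deficit (fun x => ENNReal.ofReal (g x)) (fun x => ENNReal.ofReal (f x)) ≤
      ENNReal.ofReal δ) : ∑ x ∈ S, max (g x - f x) 0 ≤ δ := by
  rw [← ENNReal.ofReal_le_ofReal_iff hδ, ENNReal.ofReal_sum_of_nonneg fun _ _ => le_max_right _ _]
  refine le_trans (Finset.sum_le_sum fun x _ => ?_) ((ENNReal.sum_le_tsum S).trans h)
  rw [← ENNReal.ofReal_sub _ (hf x)]
  rcases le_total (g x - f x) 0 with h0 | h0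
  · simp [max_eq_right h0]
  · rw [max_eq_left h0]

theorem half_sum_abs_sub_le (hsum : ∑ x ∈ S, f x = ∑ x ∈ S, g x)
    (h : ∑ x ∈ S, max (g x - f x) 0 ≤ δ) : 1 / 2 * ∑ x ∈ S, |f x - g x| ≤ δ := by
  have h1 : ∀ x, |f x - g x| = 2 * max (g x - f x) 0 + (f x - g x) := by
    intro x
    rcases le_total (g x - f x) 0 with h0 | h0
    · rw [max_eq_right h0, abs_of_nonneg (by linarith)]; ring
    · rw [max_eq_left h0, abs_of_nonpos (by linarith)]; ring
  simp only [h1]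
  rw [Finset.sum_add_distrib, ← Finset.mul_sum, Finset.sum_sub_distrib]
  linarith

/-- The one-sided bound is used on the event and on its complement; equal totals convert the latter
into the opposite inequality. -/
theorem abs_sum_filter_sub_le (hsum : ∑ x ∈ S, f x = ∑ x ∈ S, g x)
    (h : ∑ x ∈ S, max (g x - f x) 0 ≤ δ) (p : ℤ → Prop) [DecidablePred p] :
    |∑ x ∈ S.filter p, f x - ∑ x ∈ S.filter p, g x| ≤ δ := by
  have hle : ∀ U ⊆ S, ∑ x ∈ U, g x - ∑ x ∈ U, f x ≤ δ := by
    intro U hU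
    rw [← Finset.sum_sub_distrib]
    refine (Finset.sum_le_sum fun x _ => le_max_left (g x - f x) 0).trans ?_
    exact (Finset.sum_le_sum_of_subset_of_nonneg hU fun _ _ _ => le_max_right _ _).trans h
  have h1 := hle _ (Finset.filter_subset p S)
  have h2 := hle _ (Finset.filter_subset (fun x => ¬ p x) S)
  have h3 := Finset.sum_filter_add_sum_filter_not S p f
  have h4 := Finset.sum_filter_add_sum_filter_not S p g
  rw [abs_le]
  constructor <;> linarith

end Comparison

/-! ### The combined noise -/

theorem sum_eight_mul_pow_le {y : ℝ} (hy0 : 0 ≤ y) (hy : y ≤ 1 / 2) (k : ℕ) :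
    ∑ j ∈ Finset.range k, 8 * y ^ (j + 1) ≤ 16 * y := by
  calc ∑ j ∈ Finset.range k, 8 * y ^ (j + 1) ≤ ∑ j ∈ Finset.range k, 8 * y * (1 / 2) ^ j := by
        refine Finset.sum_le_sum fun j _ => ?_
        rw [pow_succ', ← mul_assoc]
        gcongr
    _ ≤ 8 * y * 2 := by
        rw [← Finset.mul_sum]
        gcongr
        exact sum_geometric_two_le k
    _ = 16 * y := by ring

/-- The hypotheses give `π σ² > 30 R² ≥ 60`, hence `σ² > 16`. -/
theorem four_le_of_exp_le {σ R ε : ℝ} (hR2 : 2 ≤ R ^ 2) (hσ0 : 0 < σ)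
    (hε : ε < Real.exp (-30)) (hε0 : 0 < ε)
    (hy : Real.exp (-(Real.pi * σ ^ 2 / R ^ 2)) ≤ ε / 2) : 4 ≤ σ := by
  have h1 : Real.exp (-(Real.pi * σ ^ 2 / R ^ 2)) < Real.exp (-30) := by linarith
  rw [Real.exp_lt_exp, neg_lt_neg_iff, lt_div_iff₀ (by linarith)] at h1
  have h2 := Real.pi_lt_d2
  by_contra! h
  have h3 : σ ^ 2 ≤ 16 := by nlinarith
  nlinarith [Real.pi_pos]

theorem law_le_law_bmod {Ω : Type*} [MeasurableSpace Ω] {μ : Measure Ω} {q : ℕ} {X : Ω → ℤ} {z : ℤ} (hz : z ∈ Zq q) :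
    law μ X z ≤ law μ (fun ω => Int.bmod (X ω) q) z :=
  measure_mono fun ω (h : X ω = z) =>
    show Int.bmod (X ω) q = z by rw [h, bmod_eq_self_of_mem_Zq hz]

/-- The weight is even; the only element of `Zq` whose negative can leave it, `-q / 2`, is fixed by
negation mod `q`. -/
theorem discreteNormal_le_law_bmod_neg {Ω : Type*} [MeasurableSpace Ω] {μ : Measure Ω} {q : ℕ}
    (hq : 0 < q) {X : Ω → ℤ} {V : ℝ}
    (hX : law μ X = fun x => ENNReal.ofReal (discreteNormal (Zq q) 0 V x)) {z : ℤ}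
    (hz : z ∈ Zq q) :
    ENNReal.ofReal (discreteNormal (Zq q) 0 V z) ≤ law μ (fun ω => Int.bmod (-X ω) q) z := by
  have hw := bmod_mem_Zq hq (-z)
  have hsq : (Int.bmod (-z) q) ^ 2 = z ^ 2 := by
    by_cases h : -(q : ℤ) < 2 * z
    · have : -z ∈ Zq q := by rw [mem_Zq] at hz ⊢; omega
      rw [bmod_eq_self_of_mem_Zq this, neg_sq]
    · have h2 : 2 * z = -(q : ℤ) := by rw [mem_Zq] at hz; omega
      have : -z = z + q := by omega
      rw [this, Int.add_bmod_right, bmod_eq_self_of_mem_Zq hz]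
  have hsq' : ((Int.bmod (-z) q : ℤ) : ℝ) ^ 2 = (z : ℝ) ^ 2 := by exact_mod_cast hsq
  have heq : discreteNormal (Zq q) 0 V z = discreteNormal (Zq q) 0 V (Int.bmod (-z) q) := by
    rw [discreteNormal, discreteNormal, if_pos hz, if_pos hw, sub_zero, sub_zero, hsq']
  rw [heq, ← congrFun hX]
  refine measure_mono fun ω (h : X ω = _) => show Int.bmod (-X ω) q = z from ?_
  rw [h, Int.bmod_neg_bmod, neg_neg, bmod_eq_self_of_mem_Zq hz]

theorem exists_unit_coefficient {ι : Type*} [Fintype ι] {c : ι → ℤ} (hgcd : Finset.univ.gcd c = 1)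
    (hR1 : ∑ i, (c i : ℝ) ^ 2 < 2) : ∃ a, (c a = 1 ∨ c a = -1) ∧ ∀ i ≠ a, c i = 0 := by
  have hR1' : ∑ i, (c i) ^ 2 < 2 := by exact_mod_cast hR1
  obtain ⟨a, ha⟩ : ∃ a, c a ≠ 0 := by
    by_contra! h
    rw [Finset.gcd_eq_zero_iff.2 fun i _ => h i] at hgcd
    exact zero_ne_one hgcd
  classical
  rw [← Finset.add_sum_erase _ _ (Finset.mem_univ a)] at hR1'
  have h1 : 1 ≤ (c a) ^ 2 := by
    have : 0 < (c a) ^ 2 := by positivity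
    omega
  have h2 : 0 ≤ ∑ i ∈ Finset.univ.erase a, (c i) ^ 2 := Finset.sum_nonneg fun _ _ => sq_nonneg _
  refine ⟨a, mul_self_eq_one_iff.1 (by rw [← sq]; omega), fun i hi => ?_⟩
  have h3 := Finset.single_le_sum (f := fun i => (c i) ^ 2) (fun i _ => sq_nonneg (c i))
    (Finset.mem_erase.2 ⟨hi, Finset.mem_univ i⟩)
  have h4 : (c i) ^ 2 ≤ 0 := h3.trans (by omega)
  exact pow_eq_zero_iff two_ne_zero |>.1 (le_antisymm h4 (sq_nonneg _))

section Noise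

variable {Ω ι : Type*} [MeasurableSpace Ω] {μ : Measure Ω} [IsProbabilityMeasure μ] [Fintype ι]
  {e : ι → Ω → ℤ} {q : ℕ} {σ ε κ R : ℝ} {c : ι → ℤ}

/-- The main regime, before reduction mod `q`: truncation contributes `6 (1 + 192 e⁴ κ) ε` and
merging `16 (ε / 2)`. -/
theorem deficit_discreteNormal_law_sum_le (hq : 0 < q) (he : ∀ i, Measurable (e i))
    (hi : iIndepFun e μ)
    (hlaw : ∀ i, law μ (e i) = fun x => ENNReal.ofReal (discreteNormal (Zq q) 0 (σ ^ 2) x))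
    (hgcd : Finset.univ.gcd c = 1) (hR0 : 0 < R) (hR : R ^ 2 = ∑ i, (c i : ℝ) ^ 2)
    (hR2 : 2 ≤ R ^ 2) (hσ : 4 ≤ σ) (hσq : σ ^ 2 < q ^ 2 / 4 / R ^ 2) (hε : 0 < ε) (hε1 : ε < 1)
    (hy : Real.exp (-(Real.pi * σ ^ 2 / R ^ 2)) ≤ ε / 2)
    (hκ : overflowProb q (σ ^ 2) R ≤ κ * ε) :
    deficit (fun x => ENNReal.ofReal (discreteNormal (Zq q) 0 (R ^ 2 * σ ^ 2) x))
      (law μ fun ω => ∑ i, c i * e i ω) ≤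
      ENNReal.ofReal ((14 + 1152 * Real.exp 4 * κ) * ε) := by
  classical
  have hσ0 : 0 < σ := by linarith
  have hV : 0 < σ ^ 2 := by positivity
  have hRV : 0 < R ^ 2 * σ ^ 2 := by positivity
  set s : Finset ι := Finset.univ.filter fun i => c i ≠ 0 with hs
  have hsg : s.gcd c = 1 := by rw [← hgcd, hs, ← Finset.gcd_eq_gcd_filter_ne_zero]
  have hsc : ∀ i ∈ s, c i ≠ 0 := fun i hi => (Finset.mem_filter.1 hi).2
  have hsne : s.Nonempty := by
    rw [Finset.nonempty_iff_ne_empty]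
    intro h
    rw [h, Finset.gcd_empty] at hsg
    exact zero_ne_one hsg
  have hsum : ∑ i ∈ s, (c i : ℝ) ^ 2 = R ^ 2 := by
    rw [hR]
    refine Finset.sum_filter_of_ne fun i _ h h0 => h ?_
    simp [h0]
  have hcard : (s.card : ℝ) ≤ R ^ 2 := by
    have := mul_gcd_sq_le_sum_sq s c hsc
    rwa [hsg, Int.cast_one, one_pow, mul_one, hsum] at this
  have hS : (∑ i ∈ s, fun ω => c i * e i ω) = fun ω => ∑ i, c i * e i ω := by
    rw [Finset.sum_fn]
    ext ω
    refine Finset.sum_filter_of_ne fun i _ h h0 => h ?_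
    simp [h0]
  have hy' : Real.exp (-(2 * Real.pi ^ 2 * σ ^ 2 / R ^ 2)) ≤ ε / 2 := by
    refine le_trans (Real.exp_le_exp.2 (neg_le_neg ?_)) hy
    gcongr
    nlinarith [Real.pi_gt_three]
  have hτ : ∀ i, deficit (latticeGaussian 1 (σ ^ 2)) (law μ (e i)) ≤ tailMass q (σ ^ 2) := by
    intro i
    rw [hlaw]
    exact deficit_latticeGaussian_discreteNormal_le hq hV
  have hmain := deficit_latticeGaussian_law_sum_le he hi hV hτ c hy' (by linarith) hsne hsc hsum.le
  rw [hsg, hsum, hS] at hmain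
  have htail : deficit (fun x => ENNReal.ofReal (discreteNormal (Zq q) 0 (R ^ 2 * σ ^ 2) x))
      (latticeGaussian 1 (R ^ 2 * σ ^ 2)) ≤ tailMass q ((R * σ) ^ 2) := by
    -- The truncation estimate is in the opposite direction, and both laws have mass one.
    rw [deficit_comm (tsum_ofReal_discreteNormal hq _) (tsum_latticeGaussian one_ne_zero hRV),
      mul_pow]
    exact deficit_latticeGaussian_discreteNormal_le hq hRV
  have hbounds := tailMass_bounds hq hR0 hR2 hσ hσq hε hy hκ
  have hgeo := sum_eight_mul_pow_le (by linarith : 0 ≤ ε / 2) (by linarith) (s.card - 1)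
  have hcard' : (s.card : ℝ≥0∞) ≤ ENNReal.ofReal (R ^ 2) := by
    rw [← ENNReal.ofReal_natCast]
    exact ENNReal.ofReal_le_ofReal hcard
  have hκ0 : 0 ≤ κ := by
    have : 0 ≤ overflowProb q (σ ^ 2) R := Finset.sum_nonneg fun x _ => discreteNormal_nonneg hq _ x
    exact nonneg_of_mul_nonneg_left (this.trans hκ) hε
  calc _ ≤ _ := deficit_triangle _ (latticeGaussian 1 (R ^ 2 * σ ^ 2)) _
    _ ≤ tailMass q ((R * σ) ^ 2) + (ENNReal.ofReal (R ^ 2) * tailMass q (σ ^ 2) +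
          ENNReal.ofReal (16 * (ε / 2))) := by
        refine add_le_add htail (hmain.trans ?_)
        gcongr
    _ = (ENNReal.ofReal (R ^ 2) * tailMass q (σ ^ 2) + tailMass q ((R * σ) ^ 2)) +
          ENNReal.ofReal (16 * (ε / 2)) := by ring
    _ ≤ ENNReal.ofReal (6 * (1 + 192 * Real.exp 4 * κ) * ε) + ENNReal.ofReal (16 * (ε / 2)) := by
        gcongr
    _ = _ := by
        rw [← ENNReal.ofReal_add (by positivity) (by positivity)]
        congr 1
        ring

/-- The combined noise, reduced modulo `q`, is close to the discrete normal distribution on `ℤ_q`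
with the combined variance parameter. -/
theorem deficit_discreteNormal_law_bmod_sum_le (hq : 0 < q) (he : ∀ i, Measurable (e i))
    (hi : iIndepFun e μ)
    (hlaw : ∀ i, law μ (e i) = fun x => ENNReal.ofReal (discreteNormal (Zq q) 0 (σ ^ 2) x))
    (hgcd : Finset.univ.gcd c = 1) (hR0 : 0 ≤ R) (hR : R ^ 2 = ∑ i, (c i : ℝ) ^ 2)
    (hσ0 : 0 < σ) (hσq : σ ^ 2 < q ^ 2 / 4 / R ^ 2) (hε : 0 < ε) (hε1 : ε < 1)
    (hy : Real.exp (-(Real.pi * σ ^ 2 / R ^ 2)) ≤ ε / 2)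
    (hκ : overflowProb q (σ ^ 2) R ≤ κ * ε) :
    deficit (fun x => ENNReal.ofReal (discreteNormal (Zq q) 0 (R ^ 2 * σ ^ 2) x))
      (law μ fun ω => Int.bmod (∑ i, c i * e i ω) q) ≤
      ENNReal.ofReal ((Real.exp 30 + 14 + 1152 * Real.exp 4 * |κ|) * ε) := by
  have hpos : 0 ≤ (14 + 1152 * Real.exp 4 * |κ|) * ε := by positivity
  rcases lt_or_ge (R ^ 2) 2 with hR2 | hR2
  -- A single coefficient `±1`: `X` has exactly the target law, so no smoothing is needed.
  · obtain ⟨a, ha, h0⟩ := exists_unit_coefficient hgcd (hR ▸ hR2)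
    have hsum : ∀ ω, ∑ i, c i * e i ω = c a * e a ω := fun ω =>
      Finset.sum_eq_single a (fun i _ hi => by rw [h0 i hi, zero_mul]) (by simp)
    have hR1 : R ^ 2 = 1 := by
      rw [hR, Finset.sum_eq_single a (fun i _ hi => by rw [h0 i hi]; simp) (by simp)]
      rcases ha with ha | ha <;> rw [ha] <;> norm_num
    simp only [hsum, hR1, one_mul]
    refine le_trans (le_of_eq ?_) zero_le
    rw [deficit, ENNReal.tsum_eq_zero]
    intro z
    rw [tsub_eq_zero_iff_le]
    by_cases hz : z ∈ Zq q
    · rcases ha with ha | ha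
      · simp only [ha, one_mul]
        rw [← congrFun (hlaw a)]
        exact law_le_law_bmod hz
      · simp only [ha, neg_one_mul]
        exact discreteNormal_le_law_bmod_neg hq (hlaw a) hz
    · simp [discreteNormal, hz]
  · rcases lt_or_ge ε (Real.exp (-30)) with hsmall | hlarge
    · have hσ := four_le_of_exp_le hR2 hσ0 hsmall hε hy
      have hRpos : 0 < R := by
        rcases hR0.eq_or_lt with h | h
        · rw [← h] at hR2; norm_num at hR2
        · exact h
      have hκ' : overflowProb q (σ ^ 2) R ≤ |κ| * ε :=
        hκ.trans (mul_le_mul_of_nonneg_right (le_abs_self κ) hε.le)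
      have h1 := deficit_discreteNormal_law_sum_le hq he hi hlaw hgcd hRpos hR hR2 hσ hσq hε hε1
        hy hκ'
      refine le_trans (ENNReal.tsum_le_tsum fun z => ?_) (h1.trans (ENNReal.ofReal_le_ofReal ?_))
      · by_cases hz : z ∈ Zq q
        · exact tsub_le_tsub_left (law_le_law_bmod hz) _
        · simp [discreteNormal, hz]
      · nlinarith [Real.exp_pos 30]
    -- For `ε ≥ exp (-30)` the trivial bound `1 ≤ exp 30 * ε` suffices.
    · have h1 : deficit (fun x => ENNReal.ofReal (discreteNormal (Zq q) 0 (R ^ 2 * σ ^ 2) x))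
          (law μ fun ω => Int.bmod (∑ i, c i * e i ω) q) ≤ 1 := by
        rw [← tsum_ofReal_discreteNormal hq (R ^ 2 * σ ^ 2)]
        exact ENNReal.tsum_le_tsum fun z => tsub_le_self
      refine h1.trans ?_
      rw [← ENNReal.ofReal_one]
      apply ENNReal.ofReal_le_ofReal
      have h2 : Real.exp 30 * Real.exp (-30) = 1 := by rw [← Real.exp_add]; norm_num
      have h3 : Real.exp 30 * Real.exp (-30) ≤ Real.exp 30 * ε := by gcongr
      linarith

end Noise

/-! ### The detector -/

theorem theorem1 (κ : ℝ) :
    ∃ C : ℝ, 0 < C ∧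
      ∀ (q n N v : ℕ) (r : ℤ) (σ ε B : ℝ)
        (T : Matrix (Fin N) (Fin n) ℤ) (P : Matrix (Fin n) (Fin v) ℤ) (d : Fin N → ℤ),
        0 < q → 0 < r → 0 < σ → 0 < ε → ε < 1 →
        -- `d` is a filtering vector (a condition on the public matrices only), and the combined noise coefficients `Tᵀ d` are coprime
        d ∈ qKer q (publicColumns (linComb q T (P, 0))) →
        Finset.univ.gcd (T.transpose.mulVec d) = 1 →
        -- the noise is large enough for smoothing
        l2norm (T.transpose.mulVec d) ^ 2 * smoothingParameter intLattice ε ^ 2 ≤ σ ^ 2 →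
        -- the noise is small enough for the modulus
        0 < B → B < 1 →
        σ ^ 2 < (q : ℝ) ^ 2 / 4 * (B ^ 2 / l2norm (T.transpose.mulVec d) ^ 2) →
        overflowProb q (σ ^ 2) (l2norm (T.transpose.mulVec d)) ≤ κ * ε →
        -- the threshold
        ∀ (α γ : ℝ), twoSidedTail q (quadForm (residualCov σ T) d) γ = α →
        -- the secret, the plaintexts (arbitrary, possibly random), the encryption errors
        ∀ (s : Fin v → ℤ) (Ω : Type*) [MeasurableSpace Ω] (μ : Measure Ω) [IsProbabilityMeasure μ]
          (m : Ω → Fin n → ℤ) (e : Fin n → Ω → ℤ),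
          (∀ i, Measurable (e i)) → iIndepFun e μ →
          (∀ i, ∀ x : ℤ, μ.real {ω | e i ω = x} = discreteNormal (Zq q) 0 (σ ^ 2) x) →
          -- the null hypothesis: the plaintext residual `T m` is zero
          (∀ ω, ∀ k, Int.bmod ((T.mulVec (m ω)) k) q = 0) →
          (∀ ω, (filtered q d (linComb q T (lweEnc q r P s (m ω) (fun i => e i ω)))).1 = 0) ∧
          statDist q
            (fun x => μ.real {ω |
              (filtered q d (linComb q T (lweEnc q r P s (m ω) (fun i => e i ω)))).2 = x})
            (discreteNormal (Zq q) 0 (quadForm (residualCov σ T) d)) ≤ C * ε ∧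
          |μ.real {ω | Rejects q d γ (linComb q T (lweEnc q r P s (m ω) (fun i => e i ω)))} - α|
            ≤ C * ε := by
  refine ⟨Real.exp 30 + 14 + 1152 * Real.exp 4 * |κ|, by positivity, ?_⟩
  intro q n N v r σ ε B T P d hq _ hσ0 hε hε1 hd hgcd hsmooth hB0 hB1 hσq hκ α γ hα s Ω _ μ _ m e
    he hi hlaw hm
  refine ⟨fun ω => filtered_fst_eq_zero hd s (m ω) _, ?_⟩
  set c := T.transpose.mulVec d with hc
  set R := l2norm c with hRdef
  have hR0 : 0 ≤ R := Real.sqrt_nonneg _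
  have hR : R ^ 2 = ∑ i, (c i : ℝ) ^ 2 := l2norm_sq c
  -- If `R` were zero, division by zero would make the upper bound on `σ²` equal to `0`.
  have hRpos : 0 < R ^ 2 := by
    rcases (sq_nonneg R).eq_or_lt with h | h
    · rw [← h, div_zero, mul_zero] at hσq
      exact absurd hσq (sq_nonneg σ).not_gt
    · exact h
  have hσq' : σ ^ 2 < q ^ 2 / 4 / R ^ 2 := by
    refine hσq.trans_le ?_
    rw [div_eq_mul_one_div ((q : ℝ) ^ 2 / 4)]
    gcongr
    exact pow_le_one₀ hB0.le hB1.le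
  have hy : Real.exp (-(Real.pi * σ ^ 2 / R ^ 2)) ≤ ε / 2 := by
    refine le_trans (Real.exp_le_exp.2 (neg_le_neg ?_)) (exp_smoothingParameter_intLattice_le hε hε1)
    rw [mul_div_assoc]
    refine mul_le_mul_of_nonneg_left ?_ Real.pi_pos.le
    rw [le_div_iff₀ hRpos, mul_comm]
    exact hsmooth
  have hlaw' : ∀ i, law μ (e i) =
      fun x => ENNReal.ofReal (discreteNormal (Zq q) 0 (σ ^ 2) x) := by
    intro i
    ext x
    rw [← hlaw i x, ofReal_measureReal]
    rfl
  have key := deficit_discreteNormal_law_bmod_sum_le hq he hi hlaw' hgcd hR0 hR hσ0 hσq' hε hε1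
    hy hκ
  have hV : quadForm (residualCov σ T) d = R ^ 2 * σ ^ 2 := by
    rw [quadForm_residualCov, hR]
  set X : Ω → ℤ := fun ω => Int.bmod (∑ i, c i * e i ω) q with hX
  have hXeq : ∀ ω, (filtered q d (linComb q T (lweEnc q r P s (m ω) fun i => e i ω))).2 = X ω :=
    fun ω => filtered_snd_eq hd s (m ω) _ (hm ω)
  have hXm : Measurable X :=
    (measurable_from_top (f := fun x : ℤ => Int.bmod x q)).comp
      (Finset.measurable_sum _ fun i _ => (he i).const_mul (c i))
  simp only [Rejects, hXeq]
  rw [hV] at hα ⊢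
  have hfl : law μ X = fun x => ENNReal.ofReal (μ.real {ω | X ω = x}) := by
    ext x
    rw [ofReal_measureReal]
    rfl
  rw [hfl] at key
  have hmax := sum_max_sub_le (S := Zq q) (fun x => measureReal_nonneg) (by positivity) key
  have hpre : ∀ U : Finset ℤ, ∑ x ∈ U, μ.real {ω | X ω = x} = μ.real (X ⁻¹' U) := fun U =>
    sum_measureReal_preimage_singleton U fun y _ => hXm (measurableSet_singleton y)
  have hXq : ∀ ω, X ω ∈ Zq q := fun ω => bmod_mem_Zq hq _
  have hsum : ∑ x ∈ Zq q, μ.real {ω | X ω = x} =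
      ∑ x ∈ Zq q, discreteNormal (Zq q) 0 (R ^ 2 * σ ^ 2) x := by
    rw [hpre, sum_discreteNormal hq]
    have : X ⁻¹' (Zq q : Set ℤ) = Set.univ := Set.eq_univ_of_forall hXq
    rw [this, probReal_univ]
  refine ⟨half_sum_abs_sub_le hsum hmax, ?_⟩
  have hrej := abs_sum_filter_sub_le hsum hmax fun x : ℤ => γ ≤ |(x : ℝ)|
  rw [hpre] at hrej
  have hset : X ⁻¹' ((Zq q).filter fun x : ℤ => γ ≤ |(x : ℝ)| : Finset ℤ) =
      {ω | γ ≤ |(X ω : ℝ)|} := by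
    ext ω
    simp [hXq ω]
  rw [hset] at hrej
  rw [← hα]
  exact hrej
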